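/- Let $(a_n)_{n\ge 1}$ be a sequence of complex numbers with $\sum_{n\ge1}|a_n|<\infty$. For $x>1$ let $P_\nu(x)={}_2F_1\left(-\nu,1+\nu;1;\frac{1-x}{2}\right)$ denote the Legendre function of the first kind (for $x\ge 3$, ${}_2F_1$ is understood as the analytic continuation of the hypergeometric series), and let $$P_\nu(x,\omega)=\sqrt{\frac{2}{\pi}}\,\frac{\Gamma(1/2)}{\Gamma(1+\nu)\,\Gamma(-\nu)}\int_0^\omega\frac{\cosh\left(t(\nu+1/2)\right)}{(\cosh t+x)^{1/2}}\,dt,\qquad \omega>0,$$ be the incomplete Legendre integral. Then for every integer $n\ge1$ $$a_n=n\tanh(\pi n)\int_1^\infty P_{in-1/2}(x,\pi)\sum_{m=1}^\infty a_m\,P_{im-1/2}(x)\,dx,$$ where the series converges absolutely for every $x>1$ and the iterated integral and series converge absolutely, i.e. $\int_1^\infty |P_{in-1/2}(x,\pi)|\sum_{m=1}^\infty|a_m P_{im-1/2}(x)|\,dx<\infty$. -/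

import Mathlib

open MeasureTheory

namespace MehlerFock

/-- The Gauss hypergeometric function `F(a, b; c; z)` on the half-plane `Re z < 1/2`: the analytic
continuation of the hypergeometric power series (which converges only for `‖z‖ < 1`), written in
closed form by `F(a, b; c; z) = (1 - z)^(-a) F(a, c - b; c; z / (z - 1))`; for `Re z < 1/2` the
argument on the right lies in the open unit disc. The theorems `gauss2F1_eq` and `gauss2F1_analytic`
below show that it agrees with the power series where both make sense, and that it is analytic on
the whole half-plane, so it is the analytic continuation. -/
noncomputable def gauss2F1 (a b c z : ℂ) : ℂ :=
  (1 - z) ^ (-a) * ordinaryHypergeometric a (c - b) c (z / (z - 1))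

/-- The associated Legendre function of the first kind `P^μ_ν(x)`, for real `x > 1`:
`1 / Γ(1 - μ) * ((x + 1) / (x - 1))^(μ / 2) * F(-ν, 1 + ν; 1 - μ; (1 - x) / 2)`. -/
noncomputable def legendreP (μ ν : ℂ) (x : ℝ) : ℂ :=
  1 / Complex.Gamma (1 - μ) * (((x + 1) / (x - 1) : ℝ) : ℂ) ^ (μ / 2) *
    gauss2F1 (-ν) (1 + ν) (1 - μ) ((1 - (x : ℂ)) / 2)

/-- The incomplete Legendre integral `P^μ_ν(x, ω)`, for real `x > 1` and `ω > 0`. -/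
noncomputable def incompleteLegendreP (μ ν : ℂ) (x ω : ℝ) : ℂ :=
  (Real.sqrt (2 / Real.pi) : ℂ) *
    (Complex.Gamma (1 / 2 - μ) * ((x ^ 2 - 1 : ℝ) : ℂ) ^ (-μ / 2) /
      (Complex.Gamma (1 + ν - μ) * Complex.Gamma (-ν - μ))) *
    ∫ t in (0 : ℝ)..ω, Complex.cosh (t * (ν + 1 / 2)) /
      ((Real.cosh t + x : ℝ) : ℂ) ^ (1 / 2 - μ)

theorem asc_left (x : ℂ) (n : ℕ) : (ascPochhammer ℂ (n + 1)).eval x =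
    x * (ascPochhammer ℂ n).eval (x + 1) := by
  simp [ascPochhammer_succ_left]

theorem asc_add (x : ℂ) (k j : ℕ) : (ascPochhammer ℂ (k + j)).eval x =
    (ascPochhammer ℂ k).eval x * (ascPochhammer ℂ j).eval (x + k) := by
  rw [← ascPochhammer_mul]; simp

theorem vander (b : ℂ) (n : ℕ) : ∀ c : ℂ, ∑ p ∈ Finset.HasAntidiagonal.antidiagonal n,
    (n.choose p.1 : ℂ) * ((-1) ^ p.1 * (ascPochhammer ℂ p.1).eval (c - b) *
      (ascPochhammer ℂ p.2).eval (c + p.1)) = (ascPochhammer ℂ n).eval b := by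
  induction n with
  | zero => intro c; simp
  | succ n ih =>
    intro c
    have h := Finset.sum_antidiagonal_choose_succ_mul (R := ℂ)
      (fun i j => (-1) ^ i * (ascPochhammer ℂ i).eval (c - b) *
      (ascPochhammer ℂ j).eval (c + i)) n
    rw [h, ascPochhammer_succ_eval]
    have h1 : ∑ p ∈ Finset.HasAntidiagonal.antidiagonal n, (n.choose p.1 : ℂ) * ((-1) ^ p.1 *
        (ascPochhammer ℂ p.1).eval (c - b) * (ascPochhammer ℂ (p.2 + 1)).eval (c + p.1)) =
        (c + n) * (ascPochhammer ℂ n).eval b := by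
      rw [← ih c, Finset.mul_sum]
      refine Finset.sum_congr rfl fun p hp => ?_
      have : (n : ℂ) = p.1 + p.2 := by
        rw [← Finset.HasAntidiagonal.mem_antidiagonal.1 hp]; push_cast; ring
      rw [ascPochhammer_succ_eval, this]; ring
    have h2 : ∑ p ∈ Finset.HasAntidiagonal.antidiagonal n, (n.choose p.2 : ℂ) * ((-1) ^ (p.1 + 1) *
        (ascPochhammer ℂ (p.1 + 1)).eval (c - b) *
          (ascPochhammer ℂ p.2).eval (c + (p.1 + 1 : ℕ))) =
        -(c - b) * (ascPochhammer ℂ n).eval b := by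
      rw [← ih (c + 1), Finset.mul_sum]
      refine Finset.sum_congr rfl fun p hp => ?_
      have : n.choose p.2 = n.choose p.1 := by
        rw [← Finset.HasAntidiagonal.mem_antidiagonal.1 hp]; exact Nat.choose_symm_add.symm
      rw [asc_left, this]
      have e : c - b + 1 = c + 1 - b := by ring
      have e2 : c + ((p.1 + 1 : ℕ) : ℂ) = c + 1 + p.1 := by push_cast; ring
      rw [e, e2]; ring
    rw [h1, h2]; ring

theorem binom_hasSum (x z : ℂ) (hz : ‖z‖ < 1) :
    HasSum (fun j : ℕ => (ascPochhammer ℂ j).eval x / (j.factorial : ℂ) * z ^ j)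
      ((1 - z) ^ (-x)) := by
  have h := (Complex.one_div_one_sub_cpow_hasFPowerSeriesOnBall_zero x).hasSum (y := z)
    (by rw [Metric.mem_eball, edist_zero_right, ← ofReal_norm]; exact ENNReal.ofReal_lt_one.2 hz)
  simp only [zero_add, one_div, ← Complex.cpow_neg] at h
  have e : (fun j : ℕ => (ascPochhammer ℂ j).eval x / (j.factorial : ℂ) * z ^ j) = fun j =>
      (FormalMultilinearSeries.ofScalars ℂ (fun n : ℕ => Ring.choose (x + (n : ℂ) - 1) n) j)
        fun _ => z := by
    funext j
    rw [FormalMultilinearSeries.ofScalars_apply_eq, smul_eq_mul]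
    congr 1
    rw [Ring.choose]
    have e : x + j - 1 - j + 1 = x := by ring
    rw [e]
    have := Ring.factorial_nsmul_multichoose_eq_ascPochhammer x j
    rw [Polynomial.ascPochhammer_smeval_eq_eval, nsmul_eq_mul] at this
    have hj : (j.factorial : ℂ) ≠ 0 := by exact_mod_cast j.factorial_ne_zero
    rw [← this]; field_simp
  rw [e]; exact h

theorem asc_norm_le (x : ℂ) (k j : ℕ) : ‖(ascPochhammer ℂ j).eval (x + k)‖ ≤
    (ascPochhammer ℝ j).eval (‖x‖ + k) := by
  induction j with
  | zero => simp
  | succ j ih =>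
    rw [ascPochhammer_succ_eval, ascPochhammer_succ_eval, norm_mul]
    have h : ‖x + k + j‖ ≤ ‖x‖ + k + j := by
      refine (norm_add₃_le).trans ?_
      simp
    exact mul_le_mul ih h (norm_nonneg _) ((norm_nonneg _).trans ih)

theorem radius_ge (a b c : ℂ) (hc : ∀ k : ℕ, c ≠ -k) :
    1 ≤ (ordinaryHypergeometricSeries ℂ a b c).radius := by
  by_cases h : ∀ k : ℕ, (k : ℂ) ≠ -a ∧ (k : ℂ) ≠ -b
  · rw [ordinaryHypergeometricSeries_radius_eq_one]
    exact fun k => ⟨(h k).1, (h k).2, fun e => hc k (by rw [e]; ring)⟩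
  · push Not at h
    obtain ⟨k, hk⟩ := h
    by_cases ha : (k : ℂ) = -a
    · obtain rfl : a = -k := by rw [ha]; ring
      rw [ordinaryHypergeometric_radius_top_of_neg_nat₁]; exact le_top
    · obtain rfl : b = -k := by rw [hk ha]; ring
      rw [ordinaryHypergeometric_radius_top_of_neg_nat₂]; exact le_top

theorem coeff_summable (a b c : ℂ) (hc : ∀ k : ℕ, c ≠ -k) (z : ℂ) (hz : ‖z‖ < 1) :
    Summable fun n : ℕ => ‖ordinaryHypergeometricCoefficient a b c n * z ^ n‖ := by
  have h := (ordinaryHypergeometricSeries ℂ a b c).summable_norm_apply (x := z) (by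
    rw [Metric.mem_eball, edist_zero_right, ← ofReal_norm]
    refine lt_of_lt_of_le ?_ (radius_ge a b c hc)
    exact ENNReal.ofReal_lt_one.2 hz)
  simpa only [ordinaryHypergeometricSeries_apply_eq, smul_eq_mul] using h

theorem f_analytic (a b c : ℂ) (hc : ∀ k : ℕ, c ≠ -k) :
    AnalyticOnNhd ℂ (ordinaryHypergeometric a b c : ℂ → ℂ) (Metric.ball 0 1) := by
  have h1 := radius_ge a b c hc
  have h := ((ordinaryHypergeometricSeries ℂ a b c).hasFPowerSeriesOnBall
    (lt_of_lt_of_le one_pos h1)).analyticOnNhd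
  refine h.mono fun z hz => ?_
  rw [mem_ball_zero_iff] at hz
  rw [Metric.mem_eball, edist_zero_right, ← ofReal_norm]
  exact lt_of_lt_of_le (ENNReal.ofReal_lt_one.2 hz) h1

theorem coeff_id (a b c z : ℂ) (hcn : ∀ n, (ascPochhammer ℂ n).eval c ≠ 0) (k j : ℕ) :
    ordinaryHypergeometricCoefficient a (c - b) c k * (-z) ^ k *
      ((ascPochhammer ℂ j).eval (a + k) / (j.factorial : ℂ) * z ^ j) =
      ((k + j).factorial : ℂ)⁻¹ * (ascPochhammer ℂ (k + j)).eval a *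
        ((ascPochhammer ℂ (k + j)).eval c)⁻¹ * z ^ (k + j) *
      (((k + j).choose k : ℂ) * ((-1) ^ k * (ascPochhammer ℂ k).eval (c - b) *
      (ascPochhammer ℂ j).eval (c + k))) := by
  have h1 := hcn (k + j)
  rw [asc_add] at h1
  rw [asc_add a, asc_add c, neg_pow z, pow_add, Nat.choose_symm_add, Nat.add_choose,
    Nat.cast_div (Nat.factorial_mul_factorial_dvd_factorial_add k j)
    (by exact_mod_cast (mul_pos k.factorial_pos j.factorial_pos).ne')]
  have h2 : ((k + j).factorial : ℂ) ≠ 0 := by exact_mod_cast (k + j).factorial_ne_zero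
  have h3 : (k.factorial : ℂ) ≠ 0 := by exact_mod_cast k.factorial_ne_zero
  have h4 : (j.factorial : ℂ) ≠ 0 := by exact_mod_cast j.factorial_ne_zero
  have h5 := left_ne_zero_of_mul h1
  have h6 := right_ne_zero_of_mul h1
  push_cast
  field_simp

theorem tsum_antidiag (T : ℕ × ℕ → ℂ) (hT : Summable T) :
    ∑' p, T p = ∑' n, ∑ p ∈ Finset.HasAntidiagonal.antidiagonal n, T p := by
  have h := (Finset.HasAntidiagonal.sigmaAntidiagonalEquivProd (A := ℕ)).summable_iff.2 hT
  have h2 := h.tsum_sigma' fun n => (hasSum_fintype _).summable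
  rw [← (Finset.HasAntidiagonal.sigmaAntidiagonalEquivProd (A := ℕ)).tsum_eq T]
  refine Eq.trans h2 (tsum_congr fun n => ?_)
  rw [tsum_fintype, Finset.univ_eq_attach]
  exact Finset.sum_attach (Finset.HasAntidiagonal.antidiagonal n) T

theorem pfaff_local (a b c : ℂ) (hc : ∀ k : ℕ, c ≠ -k) (z : ℂ) (hz : ‖z‖ < 1 / 2) :
    gauss2F1 a b c z = ordinaryHypergeometric a b c z := by
  have hz1 : ‖z‖ < 1 := by linarith
  have hne : (1 - z) ≠ 0 := by
    intro h
    have : z = 1 := by linear_combination -h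
    rw [this] at hz1; simp at hz1
  have hcn : ∀ n, (ascPochhammer ℂ n).eval c ≠ 0 := by
    intro n h
    obtain ⟨k, -, hk⟩ := (ascPochhammer_eval_eq_zero_iff n c).1 h
    exact hc k (by rw [hk]; ring)
  set g : ℕ → ℂ := ordinaryHypergeometricCoefficient a (c - b) c with hg
  let T : ℕ × ℕ → ℂ := fun p => g p.1 * (-z) ^ p.1 *
    ((ascPochhammer ℂ p.2).eval (a + p.1) / (p.2.factorial : ℂ) * z ^ p.2)
  let B : ℕ × ℕ → ℝ := fun p => ‖g p.1 * z ^ p.1‖ *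
    ((ascPochhammer ℝ p.2).eval (‖a‖ + p.1) / (p.2.factorial : ℝ) * ‖z‖ ^ p.2)
  have hB1 : ∀ k : ℕ, HasSum (fun j => B (k, j))
      (‖g k * z ^ k‖ * (1 - ‖z‖) ^ (-(‖a‖ + k))) := by
    intro k
    have h := binom_hasSum ((‖a‖ + k : ℝ) : ℂ) (‖z‖ : ℂ) (by simpa using hz1)
    have h' : HasSum (fun j : ℕ => (ascPochhammer ℝ j).eval (‖a‖ + k) / (j.factorial : ℝ)
        * ‖z‖ ^ j) ((1 - ‖z‖) ^ (-(‖a‖ + k))) := by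
      rw [← Complex.hasSum_ofReal]
      convert h using 1
      · funext j
        have : (ascPochhammer ℂ j).eval ((‖a‖ + k : ℝ) : ℂ) =
            (((ascPochhammer ℝ j).eval (‖a‖ + k) : ℝ) : ℂ) := by
          have := Polynomial.eval_map_algebraMap (ascPochhammer ℝ j) ((‖a‖ + k : ℝ) : ℂ)
          rw [ascPochhammer_map] at this
          rw [this]
          exact Polynomial.aeval_algebraMap_apply ℂ (‖a‖ + k : ℝ) _
        rw [this]; push_cast; rfl
      · rw [Complex.ofReal_cpow (by linarith)]; push_cast; rfl
    exact h'.mul_left _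
  have hB : Summable B := by
    refine (summable_prod_of_nonneg ?_).2 ⟨fun k => (hB1 k).summable, ?_⟩
    · intro p
      change 0 ≤ ‖g p.1 * z ^ p.1‖ *
        ((ascPochhammer ℝ p.2).eval (‖a‖ + p.1) / (p.2.factorial : ℝ) * ‖z‖ ^ p.2)
      refine mul_nonneg (norm_nonneg _) (mul_nonneg (div_nonneg ?_ (by positivity)) (by positivity))
      exact (norm_nonneg _).trans (asc_norm_le a p.1 p.2)
    · have hw : ‖(((‖z‖ / (1 - ‖z‖) : ℝ)) : ℂ)‖ < 1 := by
        rw [Complex.norm_real, Real.norm_of_nonneg (div_nonneg (norm_nonneg _) (by linarith)),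
          div_lt_one (by linarith)]
        linarith
      have hs : Summable fun k : ℕ => (1 - ‖z‖) ^ (-‖a‖) *
          ‖g k * ((‖z‖ / (1 - ‖z‖) : ℝ) : ℂ) ^ k‖ := by
        have h := coeff_summable a (c - b) c hc _ hw
        rw [← hg] at h
        exact h.mul_left ((1 - ‖z‖) ^ (-‖a‖))
      have hk : ∀ k : ℕ, ∑' j, B (k, j) = (1 - ‖z‖) ^ (-‖a‖) *
          ‖g k * ((‖z‖ / (1 - ‖z‖) : ℝ) : ℂ) ^ k‖ := by
        intro k
        rw [(hB1 k).tsum_eq, neg_add, Real.rpow_add (by linarith),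
          Real.rpow_neg (by linarith) (k : ℝ), Real.rpow_natCast, norm_mul (g k), norm_mul (g k),
          norm_pow, norm_pow, Complex.norm_real,
          Real.norm_of_nonneg (div_nonneg (norm_nonneg _) (by linarith)), div_pow]
        ring
      exact (summable_congr hk).2 hs
  have hle : ∀ p, ‖T p‖ ≤ B p := by
    intro p
    have h1 : ‖T p‖ = ‖g p.1 * z ^ p.1‖ *
        (‖(ascPochhammer ℂ p.2).eval (a + p.1)‖ / (p.2.factorial : ℝ) * ‖z‖ ^ p.2) := by
      simp only [T, norm_mul, norm_div, norm_pow, norm_neg, Complex.norm_natCast]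
    rw [h1]
    exact mul_le_mul_of_nonneg_left (mul_le_mul_of_nonneg_right
      (div_le_div_of_nonneg_right (asc_norm_le a p.1 p.2) (Nat.cast_nonneg _))
      (pow_nonneg (norm_nonneg _) _)) (norm_nonneg _)
  have hT : Summable T := hB.of_norm_bounded hle
  have hT1 : ∀ k : ℕ, HasSum (fun j => T (k, j)) (g k * (-z) ^ k * (1 - z) ^ (-(a + k))) :=
    fun k => (binom_hasSum (a + k) z hz1).mul_left (g k * (-z) ^ k)
  have e1 : ∑' p, T p = gauss2F1 a b c z := by
    rw [hT.tsum_prod' fun k => (hT1 k).summable, gauss2F1, ordinaryHypergeometric_eq_tsum]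
    simp only
    rw [← tsum_mul_left]
    refine tsum_congr fun k => ?_
    rw [(hT1 k).tsum_eq, neg_add, Complex.cpow_add _ _ hne, Complex.cpow_neg _ (k : ℂ),
      Complex.cpow_natCast, smul_eq_mul, hg]
    have : z / (z - 1) = -z / (1 - z) := by
      rw [← neg_div_neg_eq]; congr 1; ring
    rw [this, div_pow]
    ring
  rw [← e1, tsum_antidiag T hT, ordinaryHypergeometric_eq_tsum]
  beta_reduce
  refine tsum_congr fun n => ?_
  have : ∀ p ∈ Finset.HasAntidiagonal.antidiagonal n, T p =
      (n.factorial : ℂ)⁻¹ * (ascPochhammer ℂ n).eval a * ((ascPochhammer ℂ n).eval c)⁻¹ * z ^ n *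
      ((n.choose p.1 : ℂ) * ((-1) ^ p.1 * (ascPochhammer ℂ p.1).eval (c - b) *
      (ascPochhammer ℂ p.2).eval (c + p.1))) := by
    rintro ⟨k, j⟩ hp
    obtain rfl := Finset.HasAntidiagonal.mem_antidiagonal.1 hp
    exact coeff_id a b c z hcn k j
  rw [Finset.sum_congr rfl this, ← Finset.mul_sum, vander, smul_eq_mul]
  ring

theorem gauss2F1_analytic (a b c : ℂ) (hc : ∀ k : ℕ, c ≠ -k) :
    AnalyticOnNhd ℂ (gauss2F1 a b c) {z | z.re < 1 / 2} := by
  intro z hz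
  have hz : z.re < 1 / 2 := hz
  have hne : z - 1 ≠ 0 := by
    intro h
    have : z = 1 := by linear_combination h
    rw [this] at hz; norm_num at hz
  have hlt : ‖z / (z - 1)‖ < 1 := by
    rw [norm_div, div_lt_one (norm_pos_iff.2 hne), ← sq_lt_sq₀ (norm_nonneg _) (norm_nonneg _),
      Complex.sq_norm, Complex.sq_norm, Complex.normSq_apply, Complex.normSq_apply]
    simp only [Complex.sub_re, Complex.sub_im, Complex.one_re, Complex.one_im]
    nlinarith
  have h1 : AnalyticAt ℂ (fun z : ℂ => (1 - z) ^ (-a)) z := by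
    refine AnalyticAt.cpow (by fun_prop) (by fun_prop) ?_
    left; simp only [Complex.sub_re, Complex.one_re]; linarith
  have h2 : AnalyticAt ℂ (fun z : ℂ => z / (z - 1)) z :=
    AnalyticAt.div (by fun_prop) (by fun_prop) hne
  have h3 := f_analytic a (c - b) c hc (z / (z - 1)) (by simpa using hlt)
  exact h1.mul (AnalyticAt.comp (f := fun z : ℂ => z / (z - 1)) h3 h2)

theorem gauss2F1_eq (a b c : ℂ) (hc : ∀ k : ℕ, c ≠ -k) (z : ℂ) (hz : ‖z‖ < 1)
    (hz' : z.re < 1 / 2) : gauss2F1 a b c z = ordinaryHypergeometric a b c z := by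
  have hpre : IsPreconnected (Metric.ball (0 : ℂ) 1 ∩ {z | z.re < 1 / 2}) :=
    ((convex_ball _ _).inter (convex_halfSpace_re_lt _)).isPreconnected
  refine AnalyticOnNhd.eqOn_of_preconnected_of_eventuallyEq (z₀ := 0)
    ((gauss2F1_analytic a b c hc).mono Set.inter_subset_right)
    ((f_analytic a b c hc).mono Set.inter_subset_left) hpre (by simp) ?_
    (show z ∈ _ from ⟨by simpa using hz, hz'⟩)
  filter_upwards [Metric.ball_mem_nhds (0 : ℂ) (by norm_num : (0 : ℝ) < 1 / 2)] with w hw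
  exact pfaff_local a b c hc w (by simpa using hw)

/-- For `1 < x < 3` the function `legendreP` is given by the hypergeometric power series. -/
theorem legendreP_eq (μ ν : ℂ) (hμ : μ.re < 1 / 2) (x : ℝ) (h1 : 1 < x) (h3 : x < 3) :
    legendreP μ ν x = 1 / Complex.Gamma (1 - μ) * (((x + 1) / (x - 1) : ℝ) : ℂ) ^ (μ / 2) *
      ordinaryHypergeometric (-ν) (1 + ν) (1 - μ) ((1 - (x : ℂ)) / 2) := by
  have e : (1 - (x : ℂ)) / 2 = (((1 - x) / 2 : ℝ) : ℂ) := by push_cast; ring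
  rw [legendreP, e, gauss2F1_eq]
  · intro k hk
    have := congrArg Complex.re hk
    simp only [Complex.sub_re, Complex.one_re, Complex.neg_re, Complex.natCast_re] at this
    have hk0 : (0 : ℝ) ≤ k := Nat.cast_nonneg k
    linarith
  · rw [Complex.norm_real, Real.norm_eq_abs, abs_lt]
    constructor <;> linarith
  · rw [Complex.ofReal_re]; linarith

end MehlerFock

open MehlerFock

open MeasureTheory

/-! The coefficients are recovered from a biorthogonality relation: the integral over `x > 1` of
`P_{in-1/2}(x, π) P_{im-1/2}(x)` is `coth(πn)/n` if `n = m` and `0` otherwise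
(`integral_incompleteLegendreP_mul_legendreP`).

On one side, `P_{im-1/2}(x)` is `1/π` times the Fourier transform in `s` of the kernel `(2(x - cosh
s))^(-1/2)` supported where `cosh s < x` (`legendreP_eq_integral_mehlerKernel`). On the other,
integration by parts makes `P_{in-1/2}(x, π)` a multiple of the integral over `0 < t < π` of
`sin(nt) sinh t (x + cosh t)^(-3/2)` (`incompleteLegendreP_eq_integral`). Integrating the two
kernels against each other in `x` gives `√2/(cosh s + cosh t)` (`integral_Ioi_mehlerKernel_mul`),
and the Fourier transform of `sinh t/(cosh s + cosh t)` in `s` is `2π sin(mt)/sinh(πm)`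
(`integral_exp_div_cosh_add_cosh`). What remains is the orthogonality of sines on `(0, π)`.

The series may be integrated term by term because `|P_{im-1/2}(x)|` has a majorant independent of
`m`, integrable against `(x + 1)^(-3/2)`, which is the decay of `P_{in-1/2}(x, π)`. -/

/-! ### Laplace's integral, from Parseval's identity for the binomial series -/

theorem integral_exp_int_mul_I (j : ℤ) :
    ∫ θ in (-Real.pi)..Real.pi, Complex.exp (j * Complex.I * (θ : ℂ)) =
      if j = 0 then 2 * (Real.pi : ℂ) else 0 := by
  split_ifs with h
  · subst h
    simp only [Int.cast_zero, zero_mul, Complex.exp_zero, intervalIntegral.integral_const,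
      sub_neg_eq_add, Complex.real_smul]
    push_cast; ring
  · have hj : (j : ℂ) * Complex.I ≠ 0 := mul_ne_zero (by exact_mod_cast h) Complex.I_ne_zero
    rw [integral_exp_mul_complex hj]
    have e : (j : ℂ) * Complex.I * (Real.pi : ℂ) =
        j * Complex.I * ((-Real.pi : ℝ) : ℂ) + j * (2 * Real.pi * Complex.I) := by
      push_cast; ring
    rw [e, Complex.exp_add, Complex.exp_int_mul_two_pi_mul_I]
    simp

/-- Parseval's identity for the binomial series. -/
theorem integral_one_sub_cpow_mul (ν : ℂ) {r : ℝ} (h0 : 0 ≤ r) (h1 : r < 1) :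
    ∫ θ in (-Real.pi)..Real.pi, (1 - r * Complex.exp (Complex.I * θ)) ^ ν *
      (1 - r * Complex.exp (-(Complex.I * θ))) ^ ν =
      2 * Real.pi * ordinaryHypergeometric (-ν) (-ν) 1 ((r : ℂ) ^ 2) := by
  obtain ⟨c, hc⟩ : ∃ c : ℕ → ℂ, ∀ k, c k = (ascPochhammer ℂ k).eval (-ν) / (k.factorial : ℂ) :=
    ⟨_, fun _ => rfl⟩
  have hn : ∀ θ : ℂ, ‖Complex.exp θ‖ = 1 → ‖(r : ℂ) * Complex.exp θ‖ < 1 := by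
    intro θ h
    rw [norm_mul, h, mul_one, Complex.norm_real, Real.norm_of_nonneg h0]; exact h1
  have hI : ∀ θ : ℝ, ‖Complex.exp (Complex.I * θ)‖ = 1 := fun θ => by
    rw [mul_comm]; exact Complex.norm_exp_ofReal_mul_I θ
  have hI' : ∀ θ : ℝ, ‖Complex.exp (-(Complex.I * θ))‖ = 1 := fun θ => by
    have := hI (-θ); push_cast at this; rwa [mul_neg] at this
  have hb : ∀ z : ℂ, ‖z‖ < 1 → HasSum (fun k => c k * z ^ k) ((1 - z) ^ ν) := by
    intro z hz
    have := binom_hasSum (-ν) z hz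
    simpa only [neg_neg, ← hc] using this
  have hsn : Summable fun k => ‖c k * (r : ℂ) ^ k‖ :=
    (hb r (by rwa [Complex.norm_real, Real.norm_of_nonneg h0])).summable.norm
  let F : ℕ × ℕ → ℝ → ℂ := fun p θ => (c p.1 * (r : ℂ) ^ p.1) * (c p.2 * (r : ℂ) ^ p.2) *
    Complex.exp (((p.1 - p.2 : ℤ) : ℂ) * Complex.I * θ)
  have hFn : ∀ p θ, ‖F p θ‖ = ‖c p.1 * (r : ℂ) ^ p.1‖ * ‖c p.2 * (r : ℂ) ^ p.2‖ := by
    intro p θ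
    have : ‖Complex.exp (((p.1 - p.2 : ℤ) : ℂ) * Complex.I * θ)‖ = 1 := by
      have e : (((p.1 - p.2 : ℤ) : ℂ) * Complex.I * θ) =
          (((p.1 - p.2 : ℤ) * θ : ℝ) : ℂ) * Complex.I := by push_cast; ring
      rw [e, Complex.norm_exp_ofReal_mul_I]
    simp only [F]
    rw [norm_mul, this, mul_one, norm_mul]
  have hF : ∀ p, Continuous (F p) := fun p => by simp only [F]; fun_prop
  have hprod : Summable fun p : ℕ × ℕ =>
      ‖c p.1 * (r : ℂ) ^ p.1‖ * ‖c p.2 * (r : ℂ) ^ p.2‖ :=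
    hsn.mul_of_nonneg hsn (fun _ => norm_nonneg _) (fun _ => norm_nonneg _)
  have hpi : -Real.pi ≤ Real.pi := by linarith [Real.pi_pos]
  have hs := hasSum_integral_of_summable_integral_norm
    (μ := volume.restrict (Set.Ioc (-Real.pi) Real.pi)) (F := F)
    (fun p => ((hF p).intervalIntegrable _ _).1) (by
      simp only [hFn, integral_const, smul_eq_mul]
      exact hprod.mul_left _)
  have hpt : ∀ θ : ℝ, ∑' p, F p θ = (1 - r * Complex.exp (Complex.I * θ)) ^ ν *
      (1 - r * Complex.exp (-(Complex.I * θ))) ^ ν := by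
    intro θ
    have h2 := hb _ (hn _ (hI θ))
    have h3 := hb _ (hn _ (hI' θ))
    rw [← h2.tsum_eq, ← h3.tsum_eq,
      tsum_mul_tsum_of_summable_norm h2.summable.norm h3.summable.norm]
    refine tsum_congr fun p => ?_
    simp only [F]
    have e : (((p.1 - p.2 : ℤ) : ℂ) * Complex.I * θ) =
      p.1 * (Complex.I * θ) + p.2 * (-(Complex.I * θ)) := by push_cast; ring
    rw [e, Complex.exp_add, Complex.exp_nat_mul, Complex.exp_nat_mul, mul_pow, mul_pow]
    ring
  simp only [hpt, ← intervalIntegral.integral_of_le hpi] at hs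
  rw [← hs.tsum_eq, ordinaryHypergeometric_eq_tsum]
  have hval : ∀ p : ℕ × ℕ, ∫ θ in (-Real.pi)..Real.pi, F p θ =
      if p.1 = p.2 then (c p.1 * (r : ℂ) ^ p.1) * (c p.2 * (r : ℂ) ^ p.2) * (2 * Real.pi)
      else 0 := by
    intro p
    simp only [F]
    rw [intervalIntegral.integral_const_mul, integral_exp_int_mul_I]
    have : ((p.1 : ℤ) - p.2 = 0) ↔ p.1 = p.2 := by omega
    simp only [this]
    split_ifs <;> simp
  simp only [hval]
  -- Only diagonal pairs survive the integration over the circle, so the double series collapses to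
  -- the sum of the squared binomial coefficients times `r^(2k)`, which is `F(-ν, -ν; 1; r²)`.
  have hinj : Function.Injective (fun k : ℕ => (k, k)) := fun a b h => (Prod.mk.inj h).1
  rw [← hinj.tsum_eq, ← tsum_mul_left]
  · refine tsum_congr fun k => ?_
    have hk : (k.factorial : ℂ) ≠ 0 := by exact_mod_cast k.factorial_ne_zero
    have h1 : (ascPochhammer ℂ k).eval 1 = (k.factorial : ℂ) := by
      simp
    simp only [if_true, smul_eq_mul, hc, h1]
    field_simp
    ring
  · intro p hp
    by_cases h : p.1 = p.2
    · exact ⟨p.1, Prod.ext rfl h⟩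
    · simp [h] at hp

/-- The two bases are complex conjugates with positive real part, so their principal logarithms are
conjugate and add up to `log ‖z‖²`; no branch correction appears, even for complex `ν`. -/
theorem one_sub_cpow_mul_conj (ν : ℂ) {r : ℝ} (h0 : 0 ≤ r) (h1 : r < 1) (θ : ℝ) :
    (1 - r * Complex.exp (Complex.I * θ)) ^ ν * (1 - r * Complex.exp (-(Complex.I * θ))) ^ ν =
      ((1 + r ^ 2 - 2 * r * Real.cos θ : ℝ) : ℂ) ^ ν := by
  set z : ℂ := 1 - r * Complex.exp (Complex.I * θ) with hz
  have hzc : 1 - r * Complex.exp (-(Complex.I * θ)) = (starRingEnd ℂ) z := by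
    rw [hz, map_sub, map_mul, ← Complex.exp_conj, map_mul]
    simp
  have hzre : z.re = 1 - r * Real.cos θ := by
    rw [hz, mul_comm Complex.I, Complex.exp_mul_I]
    simp [← Complex.ofReal_cos, ← Complex.ofReal_sin]
  have hzim : z.im = - (r * Real.sin θ) := by
    rw [hz, mul_comm Complex.I, Complex.exp_mul_I]
    simp [← Complex.ofReal_cos, ← Complex.ofReal_sin]
  have hre : 0 < z.re := by
    rw [hzre]; nlinarith [Real.cos_le_one θ]
  have hne : z ≠ 0 := fun h => by rw [h] at hre; simp at hre
  have hne' : (starRingEnd ℂ) z ≠ 0 := by simpa using hne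
  have harg : z.arg ≠ Real.pi := by
    intro h
    have := Complex.abs_arg_lt_pi_div_two_iff.2 (Or.inl hre)
    rw [h, abs_of_pos Real.pi_pos] at this
    linarith [Real.pi_pos]
  have hsq : ((1 + r ^ 2 - 2 * r * Real.cos θ : ℝ)) = ‖z‖ ^ 2 := by
    rw [Complex.sq_norm, Complex.normSq_apply, hzre, hzim]
    nlinarith [Real.sin_sq_add_cos_sq θ]
  have hpos : 0 < ‖z‖ := norm_pos_iff.2 hne
  rw [hzc, Complex.cpow_def_of_ne_zero hne, Complex.cpow_def_of_ne_zero hne', hsq,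
    Complex.cpow_def_of_ne_zero (by exact_mod_cast (pow_pos hpos 2).ne'), ← Complex.exp_add,
    Complex.log_conj _ harg, ← add_mul, Complex.add_conj, ← Complex.ofReal_log (by positivity),
    Real.log_pow, Complex.log_re]
  push_cast; rfl

theorem sub_sqrt_mul_cos_pos {x : ℝ} (hx : 1 < x) (θ : ℝ) :
    0 < x - Real.sqrt (x ^ 2 - 1) * Real.cos θ := by
  have h3 : Real.sqrt (x ^ 2 - 1) < x := by
    rw [Real.sqrt_lt' (by linarith)]; linarith
  nlinarith [Real.cos_le_one θ, Real.sqrt_nonneg (x ^ 2 - 1)]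

/-- Laplace's integral for the Legendre function of the first kind. -/
theorem legendreP_eq_laplace_integral (ν : ℂ) {x : ℝ} (hx : 1 < x) :
    legendreP 0 ν x = 1 / Real.pi *
      ∫ θ in (0 : ℝ)..Real.pi, ((x - Real.sqrt (x ^ 2 - 1) * Real.cos θ : ℝ) : ℂ) ^ ν := by
  have hx1 : 0 < x + 1 := by linarith
  have hx0 : 0 < x - 1 := by linarith
  -- With this `r` the argument `z/(z - 1)` in `gauss2F1` is `r²`, and `(x + 1)/2 · (1 + r² - 2r cos
  -- θ) = x - √(x² - 1) cos θ`.
  set r : ℝ := Real.sqrt ((x - 1) / (x + 1)) with hr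
  have hr2 : r ^ 2 = (x - 1) / (x + 1) := Real.sq_sqrt (by positivity)
  have h0 : 0 ≤ r := Real.sqrt_nonneg _
  have h1 : r < 1 := by
    have : r ^ 2 < 1 := by rw [hr2, div_lt_one hx1]; linarith
    nlinarith
  have hrs : (x + 1) * r = Real.sqrt (x ^ 2 - 1) := by
    rw [eq_comm, Real.sqrt_eq_iff_mul_self_eq (by nlinarith) (by positivity)]
    have : (x + 1) * r * ((x + 1) * r) = (x + 1) ^ 2 * r ^ 2 := by ring
    rw [this, hr2]; field_simp; ring
  have hpar := integral_one_sub_cpow_mul ν h0 h1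
  -- The definition of `gauss2F1` is already in Pfaff form, with second parameter `1 - (1 + ν) =
  -- -ν`, so the symmetric function needed for Parseval appears at once.
  have hP : legendreP 0 ν x = (((x + 1) / 2 : ℝ) : ℂ) ^ ν *
      ordinaryHypergeometric (-ν) (-ν) 1 ((r : ℂ) ^ 2) := by
    rw [legendreP, gauss2F1]
    have e1 : (1 : ℂ) - (1 - x) / 2 = (((x + 1) / 2 : ℝ) : ℂ) := by push_cast; ring
    have e2 : (1 - (x : ℂ)) / 2 / ((1 - x) / 2 - 1) = (r : ℂ) ^ 2 := by
      rw [← Complex.ofReal_pow, hr2]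
      push_cast
      have h3 : (x : ℂ) + 1 ≠ 0 := by exact_mod_cast hx1.ne'
      have h4 : (1 - (x : ℂ)) / 2 - 1 ≠ 0 := by
        intro h; apply h3; linear_combination -2 * h
      rw [div_eq_div_iff h4 h3]
      ring
    rw [e1, e2]
    simp
  have hint : ∀ θ : ℝ, (((x + 1) / 2 : ℝ) : ℂ) ^ ν *
      ((1 - r * Complex.exp (Complex.I * θ)) ^ ν *
        (1 - r * Complex.exp (-(Complex.I * θ))) ^ ν) =
      ((x - Real.sqrt (x ^ 2 - 1) * Real.cos θ : ℝ) : ℂ) ^ ν := by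
    intro θ
    have hnn : 0 ≤ 1 + r ^ 2 - 2 * r * Real.cos θ := by
      nlinarith [Real.cos_sq_add_sin_sq θ, sq_nonneg (r - Real.cos θ), sq_nonneg (Real.sin θ)]
    rw [one_sub_cpow_mul_conj ν h0 h1, ← Complex.mul_cpow_ofReal_nonneg (by positivity) hnn,
      ← Complex.ofReal_mul]
    congr 2
    rw [← hrs, hr2]
    field_simp
    ring
  have heven : ∫ θ in (-Real.pi)..Real.pi,
      ((x - Real.sqrt (x ^ 2 - 1) * Real.cos θ : ℝ) : ℂ) ^ ν =
      2 * ∫ θ in (0 : ℝ)..Real.pi, ((x - Real.sqrt (x ^ 2 - 1) * Real.cos θ : ℝ) : ℂ) ^ ν := by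
    have hcont : Continuous fun θ : ℝ =>
        ((x - Real.sqrt (x ^ 2 - 1) * Real.cos θ : ℝ) : ℂ) ^ ν := by
      refine Continuous.cpow (by fun_prop) continuous_const fun θ => ?_
      exact Complex.ofReal_mem_slitPlane.2 (sub_sqrt_mul_cos_pos hx θ)
    rw [← intervalIntegral.integral_add_adjacent_intervals (b := 0)
      (hcont.intervalIntegrable _ _) (hcont.intervalIntegrable _ _), two_mul]
    congr 1
    have := intervalIntegral.integral_comp_neg (a := 0) (b := Real.pi)
      (fun θ : ℝ => ((x - Real.sqrt (x ^ 2 - 1) * Real.cos θ : ℝ) : ℂ) ^ ν)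
    simp only [Real.cos_neg, neg_zero] at this
    exact this.symm
  have hpi : (Real.pi : ℂ) ≠ 0 := by exact_mod_cast Real.pi_ne_zero
  have key : (2 * Real.pi : ℂ) * legendreP 0 ν x =
      2 * ∫ θ in (0 : ℝ)..Real.pi, ((x - Real.sqrt (x ^ 2 - 1) * Real.cos θ : ℝ) : ℂ) ^ ν := by
    rw [← heven, hP, mul_left_comm, ← hpar, ← intervalIntegral.integral_const_mul]
    exact intervalIntegral.integral_congr fun θ _ => hint θ
  field_simp
  linear_combination key / 2

/-! ### The Fourier transform of `sinh t / (cosh s + cosh t)` -/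

theorem sigmoid_mul_one_sub (s : ℝ) :
    Real.sigmoid s * (1 - Real.sigmoid s) = 1 / (2 * (Real.cosh s + 1)) := by
  have h := Real.exp_pos s
  rw [Real.sigmoid_def, Real.cosh_eq, Real.exp_neg]
  field_simp
  ring

theorem sigmoid_div_one_sub (s : ℝ) :
    Real.sigmoid s / (1 - Real.sigmoid s) = Real.exp s := by
  have h := Real.exp_pos s
  rw [← Real.sigmoid_neg, Real.sigmoid_def, Real.sigmoid_def, neg_neg, Real.exp_neg]
  field_simp
  ring

/-- Reduces the Fourier transform of the right side to that of the derivative of the sigmoid,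
translated by `±t`. -/
theorem sigmoid_add_sub_sigmoid_sub (s t : ℝ) :
    Real.sigmoid (s + t) - Real.sigmoid (s - t) = Real.sinh t / (Real.cosh s + Real.cosh t) := by
  have hs := Real.exp_pos s
  have ht := Real.exp_pos t
  rw [Real.sigmoid_def, Real.sigmoid_def, Real.sinh_eq, Real.cosh_eq, Real.cosh_eq,
    neg_add, neg_sub, sub_eq_add_neg t, Real.exp_add, Real.exp_add, Real.exp_neg, Real.exp_neg]
  field_simp
  ring

/-- For `c = 1` the function is twice the derivative of the sigmoid, whose range `(0, 1)` has finite
length; larger `c` follows by comparison. -/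
theorem integrable_inv_cosh_add {c : ℝ} (hc : 1 ≤ c) :
    Integrable fun s : ℝ => 1 / (Real.cosh s + c) := by
  have h1 : Integrable fun s : ℝ => Real.sigmoid s * (1 - Real.sigmoid s) := by
    have h := integrableOn_image_iff_integrableOn_abs_deriv_smul (s := Set.univ)
      (f := Real.sigmoid) (f' := fun s => Real.sigmoid s * (1 - Real.sigmoid s))
      MeasurableSet.univ (fun x _ => (Real.hasDerivAt_sigmoid x).hasDerivWithinAt)
      Real.sigmoid_injective.injOn (fun _ => (1 : ℝ))
    rw [Set.image_univ, Real.range_sigmoid, integrableOn_univ] at h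
    have h2 := h.1 (by simp)
    refine h2.congr (Filter.Eventually.of_forall fun s => ?_)
    have := Real.sigmoid_pos s
    have := Real.sigmoid_lt_one s
    simp only [smul_eq_mul, mul_one]
    exact abs_of_nonneg (mul_nonneg (by linarith) (by linarith))
  refine (h1.const_mul 2).mono' ?_ (Filter.Eventually.of_forall fun s => ?_)
  · refine Continuous.aestronglyMeasurable ?_
    refine Continuous.div continuous_const (by fun_prop) fun s => ?_
    have := Real.one_le_cosh s
    linarith
  · have := Real.one_le_cosh s
    rw [sigmoid_mul_one_sub, Real.norm_of_nonneg (by positivity)]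
    rw [show 2 * (1 / (2 * (Real.cosh s + 1))) = 1 / (Real.cosh s + 1) by field_simp]
    exact one_div_le_one_div_of_le (by linarith) (by linarith)

/-- Since `Γ(2) = 1`, this is `Γ(1 + im) Γ(1 - im) = im Γ(im) Γ(1 - im)`, evaluated by the
reflection formula. -/
theorem betaIntegral_one_add_one_sub_I_mul {m : ℝ} (hm : m ≠ 0) :
    Complex.betaIntegral (1 + Complex.I * m) (1 - Complex.I * m) =
      Real.pi * m / Complex.sinh (Real.pi * m) := by
  have h := Complex.Gamma_mul_Gamma_eq_betaIntegral (s := 1 + Complex.I * m)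
    (t := 1 - Complex.I * m) (by simp) (by simp)
  have hI : Complex.I * (m : ℂ) ≠ 0 := mul_ne_zero Complex.I_ne_zero (by exact_mod_cast hm)
  have h2 : Complex.Gamma (1 + Complex.I * m + (1 - Complex.I * m)) = 1 := by
    have : (1 + Complex.I * m + (1 - Complex.I * m) : ℂ) = 1 + 1 := by ring
    rw [this, Complex.Gamma_add_one _ one_ne_zero, Complex.Gamma_one, one_mul]
  rw [h2, one_mul, add_comm 1, Complex.Gamma_add_one _ hI, mul_assoc,
    Complex.Gamma_mul_Gamma_one_sub] at h
  rw [add_comm 1, ← h]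
  have e : (Real.pi : ℂ) * (Complex.I * m) = (Real.pi * m) * Complex.I := by ring
  rw [e, Complex.sin_mul_I]
  have hs : Complex.sinh (Real.pi * m) ≠ 0 := by
    rw [← Complex.ofReal_mul, ← Complex.ofReal_sinh]
    exact_mod_cast Real.sinh_ne_zero.2 (mul_ne_zero Real.pi_ne_zero hm)
  field_simp

/-- Under `y = sigmoid s` one has `y/(1 - y) = e^s`, so `e^(ims) = y^(im) (1 - y)^(-im)` and the
integral becomes a beta integral over `(0, 1)`. -/
theorem integral_exp_mul_sigmoid_deriv {m : ℝ} (hm : m ≠ 0) :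
    ∫ s : ℝ, Complex.exp (Complex.I * m * s) *
      ((Real.sigmoid s * (1 - Real.sigmoid s) : ℝ) : ℂ) =
      Real.pi * m / Complex.sinh (Real.pi * m) := by
  rw [← betaIntegral_one_add_one_sub_I_mul hm, Complex.betaIntegral,
    intervalIntegral.integral_of_le zero_le_one, integral_Ioc_eq_integral_Ioo,
    ← Real.range_sigmoid, ← Set.image_univ,
    integral_image_eq_integral_abs_deriv_smul MeasurableSet.univ
      (fun x _ => (Real.hasDerivAt_sigmoid x).hasDerivWithinAt)
      Real.sigmoid_injective.injOn, setIntegral_univ]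
  refine integral_congr_ae (Filter.Eventually.of_forall fun s => ?_)
  have h0 := Real.sigmoid_pos s
  have h1 := Real.sigmoid_lt_one s
  have h2 : 0 < 1 - Real.sigmoid s := by linarith
  simp only
  rw [abs_of_pos (mul_pos h0 h2), Complex.real_smul, mul_comm]
  congr 1
  have e1 : (1 : ℂ) + Complex.I * m - 1 = Complex.I * m := by ring
  have e2 : (1 : ℂ) - Complex.I * m - 1 = -(Complex.I * m) := by ring
  have e3 : (1 : ℂ) - (Real.sigmoid s : ℂ) = ((1 - Real.sigmoid s : ℝ) : ℂ) := by push_cast; rfl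
  have hl : Real.log (Real.sigmoid s) - Real.log (1 - Real.sigmoid s) = s := by
    rw [← Real.log_div h0.ne' h2.ne', sigmoid_div_one_sub, Real.log_exp]
  rw [e1, e2, e3, Complex.cpow_def_of_ne_zero (by exact_mod_cast h0.ne'),
    Complex.cpow_def_of_ne_zero (by exact_mod_cast h2.ne'), ← Complex.exp_add,
    ← Complex.ofReal_log h0.le, ← Complex.ofReal_log h2.le]
  congr 1
  have hl' : (Real.log (Real.sigmoid s) : ℂ) - Real.log (1 - Real.sigmoid s) = s := by
    exact_mod_cast hl
  linear_combination -(Complex.I * m) * hl'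

theorem norm_exp_I_mul_mul (m s : ℝ) : ‖Complex.exp (Complex.I * m * s)‖ = 1 := by
  have e : Complex.I * m * s = ((m * s : ℝ) : ℂ) * Complex.I := by push_cast; ring
  rw [e, Complex.norm_exp_ofReal_mul_I]

theorem integrable_exp_mul_ofReal (m : ℝ) {f : ℝ → ℝ} (hf : Integrable f) :
    Integrable fun s : ℝ => Complex.exp (Complex.I * m * s) * (f s : ℂ) :=
  hf.ofReal.bdd_mul (c := 1) (Continuous.aestronglyMeasurable (by fun_prop))
    (Filter.Eventually.of_forall fun s => (norm_exp_I_mul_mul m s).le)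

/-- Integrating by parts replaces the difference of sigmoids by a difference of translates of the
sigmoid's derivative. The translations by `±t` contribute the factors `e^(∓imt)`, which combine into
the sine. -/
theorem integral_exp_div_cosh_add_cosh {m : ℝ} (hm : m ≠ 0) (t : ℝ) :
    ∫ s : ℝ, Complex.exp (Complex.I * m * s) *
      ((Real.sinh t / (Real.cosh s + Real.cosh t) : ℝ) : ℂ) =
      2 * Real.pi * Complex.sin (m * t) / Complex.sinh (Real.pi * m) := by
  set l : ℝ → ℝ := fun s => Real.sigmoid s * (1 - Real.sigmoid s) with hl
  have hli : Integrable l := by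
    have := (integrable_inv_cosh_add le_rfl).const_mul (1 / 2)
    refine this.congr (Filter.Eventually.of_forall fun s => ?_)
    simp only [hl]
    rw [sigmoid_mul_one_sub]
    have := Real.one_le_cosh s
    field_simp
  have hI : Complex.I * (m : ℂ) ≠ 0 := mul_ne_zero Complex.I_ne_zero (by exact_mod_cast hm)
  have hshift : ∀ w : ℝ, ∫ s : ℝ, Complex.exp (Complex.I * m * s) * (l (s + w) : ℂ) =
      Complex.exp (-(Complex.I * m * w)) * (Real.pi * m / Complex.sinh (Real.pi * m)) := by
    intro w
    rw [← integral_exp_mul_sigmoid_deriv hm, ← integral_const_mul,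
      ← integral_add_right_eq_self (fun s : ℝ => Complex.exp (-(Complex.I * m * w)) *
        (Complex.exp (Complex.I * m * s) * ((Real.sigmoid s * (1 - Real.sigmoid s) : ℝ) : ℂ))) w]
    refine integral_congr_ae (Filter.Eventually.of_forall fun s => ?_)
    simp only [hl]
    rw [← mul_assoc, ← Complex.exp_add]
    congr 2
    push_cast; ring
  -- The boundary terms vanish because `u * v` is itself integrable, so no limits at infinity have
  -- to be computed.
  have hib := integral_mul_deriv_eq_deriv_mul_of_integrable
    (u := fun s : ℝ => ((Real.sigmoid (s + t) - Real.sigmoid (s - t) : ℝ) : ℂ))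
    (v := fun s : ℝ => Complex.exp (Complex.I * m * s) / (Complex.I * m))
    (u' := fun s : ℝ => ((l (s + t) - l (s - t) : ℝ) : ℂ))
    (v' := fun s : ℝ => Complex.exp (Complex.I * m * s))
    (fun s _ => by
      refine HasDerivAt.ofReal_comp ?_
      exact ((Real.hasDerivAt_sigmoid (s + t)).comp_add_const s t).sub
        ((Real.hasDerivAt_sigmoid (s - t)).comp_sub_const s t))
    (fun s _ => by
      have h := ((((hasDerivAt_id (s : ℂ)).const_mul (Complex.I * m)).cexp).div_const
        (Complex.I * m)).comp_ofReal
      simpa [hI] using h)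
  have hfi : Integrable fun s : ℝ => (Real.sigmoid (s + t) - Real.sigmoid (s - t)) := by
    simp only [sigmoid_add_sub_sigmoid_sub]
    have := (integrable_inv_cosh_add (Real.one_le_cosh t)).const_mul (Real.sinh t)
    simpa only [mul_one_div] using this
  have hdi : Integrable fun s : ℝ => l (s + t) - l (s - t) :=
    (hli.comp_add_right t).sub (hli.comp_sub_right t)
  have h1 := hib (by
      refine (integrable_exp_mul_ofReal m hfi).congr (Filter.Eventually.of_forall fun s => ?_)
      simp only [Pi.mul_apply]; ring) (by
      refine ((integrable_exp_mul_ofReal m hdi).div_const (Complex.I * m)).congr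
        (Filter.Eventually.of_forall fun s => ?_)
      simp only [Pi.mul_apply]; ring) (by
      refine ((integrable_exp_mul_ofReal m hfi).div_const (Complex.I * m)).congr
        (Filter.Eventually.of_forall fun s => ?_)
      simp only [Pi.mul_apply]; ring)
  have h2 : ∫ s : ℝ, ((l (s + t) - l (s - t) : ℝ) : ℂ) *
      (Complex.exp (Complex.I * m * s) / (Complex.I * m)) =
      (∫ s : ℝ, Complex.exp (Complex.I * m * s) * (l (s + t) : ℂ)) / (Complex.I * m) -
      (∫ s : ℝ, Complex.exp (Complex.I * m * s) * (l (s + -t) : ℂ)) / (Complex.I * m) := by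
    rw [← integral_div, ← integral_div, ← integral_sub
      ((integrable_exp_mul_ofReal m (hli.comp_add_right t)).div_const _)
      ((integrable_exp_mul_ofReal m (hli.comp_add_right (-t))).div_const _)]
    refine integral_congr_ae (Filter.Eventually.of_forall fun s => ?_)
    simp only [sub_eq_add_neg]
    push_cast; ring
  rw [h2, hshift, hshift] at h1
  simp only [← sigmoid_add_sub_sigmoid_sub]
  simp only [mul_comm (Complex.exp _)]
  rw [h1, Complex.sin]
  have e1 : -(Complex.I * (m : ℂ) * ((-t : ℝ) : ℂ)) = m * t * Complex.I := by push_cast; ring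
  have e2 : -(Complex.I * (m : ℂ) * (t : ℂ)) = -(m * t) * Complex.I := by ring
  have hs : Complex.sinh (Real.pi * m) ≠ 0 := by
    rw [← Complex.ofReal_mul, ← Complex.ofReal_sinh]
    exact_mod_cast Real.sinh_ne_zero.2 (mul_ne_zero Real.pi_ne_zero hm)
  have hm' : (m : ℂ) ≠ 0 := by exact_mod_cast hm
  rw [e1, e2]
  field_simp
  rw [Complex.I_sq]
  ring

/-! ### The Mehler–Dirichlet integral, from Laplace's integral -/

/-- The kernel of the Mehler–Dirichlet integral; it vanishes for `x ≤ cosh s`, where the square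
root is zero. -/
noncomputable def mehlerKernel (x s : ℝ) : ℝ := (Real.sqrt (2 * (x - Real.cosh s)))⁻¹

theorem mehlerKernel_nonneg (x s : ℝ) : 0 ≤ mehlerKernel x s :=
  inv_nonneg.2 (Real.sqrt_nonneg _)

theorem mehlerKernel_eq_zero {x s : ℝ} (h : x ≤ Real.cosh s) : mehlerKernel x s = 0 := by
  rw [mehlerKernel, Real.sqrt_eq_zero_of_nonpos (by linarith), inv_zero]

theorem measurable_mehlerKernel : Measurable fun p : ℝ × ℝ => mehlerKernel p.1 p.2 := by
  unfold mehlerKernel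
  have : Measurable Real.cosh := Real.measurable_cosh
  fun_prop

/-- Multiplying `2 cosh u < 2x` by `e^u` and completing the square turns it into `|x - e^u| < √(x² -
1)`, which says that `(x - e^u)/√(x² - 1)` is the cosine of an angle in `(0, π)`. -/
theorem image_log_sub_sqrt_mul_cos {x : ℝ} (hx : 1 < x) :
    (fun θ => Real.log (x - Real.sqrt (x ^ 2 - 1) * Real.cos θ)) '' Set.Ioo 0 Real.pi =
      {u | Real.cosh u < x} := by
  set b := Real.sqrt (x ^ 2 - 1) with hb
  have hb2 : b ^ 2 = x ^ 2 - 1 := Real.sq_sqrt (by nlinarith)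
  have hb0 : 0 < b := Real.sqrt_pos.2 (by nlinarith)
  ext u
  constructor
  · rintro ⟨θ, ⟨h0, h1⟩, rfl⟩
    have hy := sub_sqrt_mul_cos_pos hx θ
    rw [← hb] at hy
    have hs := Real.sin_pos_of_pos_of_lt_pi h0 h1
    change Real.cosh (Real.log _) < x
    rw [Real.cosh_log hy, div_lt_iff₀ two_pos, ← sub_pos]
    have : x * 2 - (x - b * Real.cos θ + (x - b * Real.cos θ)⁻¹) =
        (b * Real.sin θ) ^ 2 / (x - b * Real.cos θ) := by
      rw [mul_pow, Real.sin_sq, eq_div_iff hy.ne', sub_mul, add_mul, inv_mul_cancel₀ hy.ne']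
      nlinarith
    rw [this]
    positivity
  · intro hu
    have hu : Real.cosh u < x := hu
    have hey := Real.exp_pos u
    have h1 : (x - Real.exp u) ^ 2 < b ^ 2 := by
      rw [Real.cosh_eq, Real.exp_neg] at hu
      have h2 : Real.exp u * (Real.exp u + (Real.exp u)⁻¹) < Real.exp u * (2 * x) :=
        mul_lt_mul_of_pos_left (by linarith) hey
      rw [mul_add, mul_inv_cancel₀ hey.ne'] at h2
      nlinarith
    have h3 := abs_lt.1 (sq_lt_sq₀ (abs_nonneg _) hb0.le |>.1 (by rwa [sq_abs]))
    have h4 : -1 < (x - Real.exp u) / b := by rw [lt_div_iff₀ hb0]; linarith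
    have h5 : (x - Real.exp u) / b < 1 := by rw [div_lt_iff₀ hb0]; linarith
    refine ⟨Real.arccos ((x - Real.exp u) / b), ⟨Real.arccos_pos.2 h5, ?_⟩, ?_⟩
    · refine lt_of_le_of_ne (Real.arccos_le_pi _) fun h => ?_
      rw [Real.arccos_eq_pi] at h; linarith
    · simp only
      rw [Real.cos_arccos h4.le h5.le, mul_div_cancel₀ _ hb0.ne', sub_sub_cancel, Real.log_exp]

theorem injOn_log_sub_sqrt_mul_cos {x : ℝ} (hx : 1 < x) :
    Set.InjOn (fun θ => Real.log (x - Real.sqrt (x ^ 2 - 1) * Real.cos θ))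
      (Set.Ioo 0 Real.pi) := by
  intro θ h θ' h' e
  have hb0 : 0 < Real.sqrt (x ^ 2 - 1) := Real.sqrt_pos.2 (by nlinarith)
  have h1 := Real.log_injOn_pos (sub_sqrt_mul_cos_pos hx θ) (sub_sqrt_mul_cos_pos hx θ') e
  have h2 : Real.cos θ = Real.cos θ' := mul_left_cancel₀ hb0.ne' (by linarith)
  exact Real.injOn_cos ⟨h.1.le, h.2.le⟩ ⟨h'.1.le, h'.2.le⟩ h2

theorem hasDerivAt_log_sub_sqrt_mul_cos {x : ℝ} (hx : 1 < x) (θ : ℝ) :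
    HasDerivAt (fun θ => Real.log (x - Real.sqrt (x ^ 2 - 1) * Real.cos θ))
      (Real.sqrt (x ^ 2 - 1) * Real.sin θ / (x - Real.sqrt (x ^ 2 - 1) * Real.cos θ)) θ := by
  have h := (((Real.hasDerivAt_cos θ).const_mul (Real.sqrt (x ^ 2 - 1))).const_sub x).log
    (sub_sqrt_mul_cos_pos hx θ).ne'
  convert h using 1
  ring

/-- Write `y = x - b cos θ` with `b = √(x² - 1)`. Then `2(x - cosh (log y)) = (b sin θ)²/y`, so the
endpoint singularity of the kernel cancels against the Jacobian `b sin θ / y`. -/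
theorem abs_deriv_mul_mehlerKernel {x : ℝ} (hx : 1 < x) {θ : ℝ} (hθ : θ ∈ Set.Ioo 0 Real.pi) :
    |Real.sqrt (x ^ 2 - 1) * Real.sin θ / (x - Real.sqrt (x ^ 2 - 1) * Real.cos θ)| *
      mehlerKernel x (Real.log (x - Real.sqrt (x ^ 2 - 1) * Real.cos θ)) =
      (Real.sqrt (x - Real.sqrt (x ^ 2 - 1) * Real.cos θ))⁻¹ := by
  have hy := sub_sqrt_mul_cos_pos hx θ
  have hs := Real.sin_pos_of_pos_of_lt_pi hθ.1 hθ.2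
  have hb0 : 0 < Real.sqrt (x ^ 2 - 1) := Real.sqrt_pos.2 (by nlinarith)
  have hb2 : Real.sqrt (x ^ 2 - 1) ^ 2 = x ^ 2 - 1 := Real.sq_sqrt (by nlinarith)
  set b := Real.sqrt (x ^ 2 - 1)
  have e : 2 * (x - (x - b * Real.cos θ + (x - b * Real.cos θ)⁻¹) / 2) =
      (b * Real.sin θ) ^ 2 / (x - b * Real.cos θ) := by
    rw [mul_pow, Real.sin_sq, eq_div_iff hy.ne']
    have := inv_mul_cancel₀ hy.ne'
    linear_combination -this - hb2
  rw [mehlerKernel, Real.cosh_log hy, e, Real.sqrt_div (sq_nonneg _),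
    Real.sqrt_sq (by positivity), abs_of_pos (by positivity)]
  have h1 := Real.sqrt_pos.2 hy
  have h2 := Real.sq_sqrt hy.le
  field_simp
  exact h2

/-- The substitution `u = log y` carries the kernel to `y^(-1/2)`, which is continuous on `[0, π]`.
-/
theorem integrable_mehlerKernel {x : ℝ} (hx : 1 < x) : Integrable (mehlerKernel x) := by
  have h := integrableOn_image_iff_integrableOn_abs_deriv_smul measurableSet_Ioo
    (fun θ _ => (hasDerivAt_log_sub_sqrt_mul_cos hx θ).hasDerivWithinAt)
    (injOn_log_sub_sqrt_mul_cos hx) (mehlerKernel x)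
  rw [image_log_sub_sqrt_mul_cos hx] at h
  rw [← integrableOn_iff_integrable_of_support_subset (s := {u | Real.cosh u < x})]
  · refine h.2 ?_
    have hc : Continuous fun θ => (Real.sqrt (x - Real.sqrt (x ^ 2 - 1) * Real.cos θ))⁻¹ :=
      Continuous.inv₀ (by fun_prop) fun θ => (Real.sqrt_pos.2 (sub_sqrt_mul_cos_pos hx θ)).ne'
    have h2 : IntegrableOn (fun θ => (Real.sqrt (x - Real.sqrt (x ^ 2 - 1) * Real.cos θ))⁻¹)
        (Set.Ioo 0 Real.pi) :=
      (hc.integrableOn_Icc (a := 0) (b := Real.pi)).mono_set Set.Ioo_subset_Icc_self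
    refine h2.congr_fun (fun θ hθ => ?_) measurableSet_Ioo
    exact (abs_deriv_mul_mehlerKernel hx hθ).symm
  · intro u hu
    by_contra hc
    exact hu (mehlerKernel_eq_zero (not_lt.1 hc))

/-- The Mehler–Dirichlet integral for conical functions. -/
theorem legendreP_eq_integral_mehlerKernel (τ : ℝ) {x : ℝ} (hx : 1 < x) :
    legendreP 0 (Complex.I * τ - 1 / 2) x =
      1 / Real.pi * ∫ s : ℝ, Complex.exp (Complex.I * τ * s) * (mehlerKernel x s : ℂ) := by
  have hsupp := setIntegral_eq_integral_of_forall_compl_eq_zero (μ := volume)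
    (s := {u | Real.cosh u < x})
    (f := fun s : ℝ => Complex.exp (Complex.I * τ * s) * (mehlerKernel x s : ℂ)) (fun u hu => by
      rw [mehlerKernel_eq_zero (not_lt.1 hu)]; simp)
  rw [legendreP_eq_laplace_integral _ hx]
  congr 1
  rw [intervalIntegral.integral_of_le Real.pi_pos.le, integral_Ioc_eq_integral_Ioo,
    ← hsupp, ← image_log_sub_sqrt_mul_cos hx,
    integral_image_eq_integral_abs_deriv_smul measurableSet_Ioo
    (fun θ _ => (hasDerivAt_log_sub_sqrt_mul_cos hx θ).hasDerivWithinAt)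
    (injOn_log_sub_sqrt_mul_cos hx)]
  refine setIntegral_congr_fun measurableSet_Ioo fun θ hθ => ?_
  have hy := sub_sqrt_mul_cos_pos hx θ
  -- The power in Laplace's integral splits as `y^(iτ - 1/2) = e^(iτ log y) y^(-1/2)`; the second
  -- factor is the Jacobian times the kernel.
  rw [Complex.real_smul, mul_left_comm, ← Complex.ofReal_mul, abs_deriv_mul_mehlerKernel hx hθ,
    sub_eq_add_neg (Complex.I * (τ : ℂ)), Complex.cpow_add _ _ (by exact_mod_cast hy.ne'),
    Complex.cpow_def_of_ne_zero (by exact_mod_cast hy.ne'), ← Complex.ofReal_log hy.le,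
    mul_comm (Complex.ofReal (Real.log _))]
  congr 1
  rw [Real.sqrt_eq_rpow (x - _), ← Real.rpow_neg hy.le, Complex.ofReal_cpow hy.le]
  push_cast; rfl

/-! ### Integration of the kernel in `x` against `(x + c)^(-3/2)` -/

theorem hasDerivAt_sqrt_div {a c x : ℝ} (hc : 0 < a + c) (hx : a < x) :
    HasDerivAt (fun x => Real.sqrt 2 / (a + c) * Real.sqrt ((x - a) / (x + c)))
      ((Real.sqrt (2 * (x - a)))⁻¹ * ((x + c) * Real.sqrt (x + c))⁻¹) x := by
  have h1 : 0 < x - a := by linarith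
  have h2 : 0 < x + c := by linarith
  have h := ((((hasDerivAt_id x).sub_const a).div ((hasDerivAt_id x).add_const c) h2.ne').sqrt
    (div_pos h1 h2).ne').const_mul (Real.sqrt 2 / (a + c))
  refine h.congr_deriv ?_
  simp only [id, Pi.div_apply]
  rw [Real.sqrt_div h1.le, Real.sqrt_mul zero_le_two]
  have h3 := Real.sqrt_pos.2 h1
  have h4 := Real.sqrt_pos.2 h2
  have h5 : 0 < Real.sqrt 2 := Real.sqrt_pos.2 two_pos
  have h6 := Real.sq_sqrt h2.le
  have h7 : Real.sqrt 2 ^ 2 = 2 := Real.sq_sqrt zero_le_two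
  field_simp
  rw [h6, h7]
  ring

/-- The kernel vanishes up to `x = cosh s`. Beyond that point the antiderivative of
`hasDerivAt_sqrt_div` rises from `0` to `√2/(cosh s + c)`, and nonnegativity of the integrand yields
integrability along with the value. -/
theorem integral_Ioi_mehlerKernel_mul {c : ℝ} (hc : 1 ≤ c) (s : ℝ) :
    IntegrableOn (fun x => mehlerKernel x s * ((x + c) * Real.sqrt (x + c))⁻¹) (Set.Ioi 1) ∧
    ∫ x in Set.Ioi (1 : ℝ), mehlerKernel x s * ((x + c) * Real.sqrt (x + c))⁻¹ =
      Real.sqrt 2 * (1 / (Real.cosh s + c)) := by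
  have ha := Real.one_le_cosh s
  have hac : 0 < Real.cosh s + c := by linarith
  set a := Real.cosh s with ha'
  have hcont : ContinuousWithinAt
      (fun x => Real.sqrt 2 / (a + c) * Real.sqrt ((x - a) / (x + c))) (Set.Ici a) a := by
    refine ContinuousAt.continuousWithinAt ?_
    have : a + c ≠ 0 := hac.ne'
    fun_prop (disch := assumption)
  have hlim : Filter.Tendsto (fun x => Real.sqrt 2 / (a + c) * Real.sqrt ((x - a) / (x + c)))
      Filter.atTop (nhds (Real.sqrt 2 / (a + c))) := by
    have h1 : Filter.Tendsto (fun x : ℝ => (x - a) / (x + c)) Filter.atTop (nhds 1) := by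
      have h2 : Filter.Tendsto (fun x : ℝ => 1 - (a + c) / (x + c)) Filter.atTop
          (nhds (1 - 0)) :=
        (Filter.Tendsto.const_div_atTop
          (Filter.tendsto_atTop_add_const_right _ c Filter.tendsto_id) (a + c)).const_sub 1
      rw [sub_zero] at h2
      refine h2.congr' ?_
      filter_upwards [Filter.eventually_gt_atTop 0] with x hx
      have : x + c ≠ 0 := by positivity
      field_simp
      ring
    have h3 := (h1.sqrt).const_mul (Real.sqrt 2 / (a + c))
    rwa [Real.sqrt_one, mul_one] at h3
  have hd : ∀ x ∈ Set.Ioi a, HasDerivAt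
      (fun x => Real.sqrt 2 / (a + c) * Real.sqrt ((x - a) / (x + c)))
      (mehlerKernel x s * ((x + c) * Real.sqrt (x + c))⁻¹) x :=
    fun x hx => hasDerivAt_sqrt_div hac hx
  have hnn : ∀ x ∈ Set.Ioi a, 0 ≤ mehlerKernel x s * ((x + c) * Real.sqrt (x + c))⁻¹ := by
    intro x hx
    have : 0 < x + c := by have : a < x := hx; linarith
    exact mul_nonneg (mehlerKernel_nonneg _ _) (by positivity)
  have hsub : Set.Ioi a ⊆ Set.Ioi 1 := Set.Ioi_subset_Ioi ha
  have hzero : ∀ x ∈ Set.Ioi (1 : ℝ) \ Set.Ioi a,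
      mehlerKernel x s * ((x + c) * Real.sqrt (x + c))⁻¹ = 0 := by
    intro x hx
    rw [mehlerKernel_eq_zero (not_lt.1 hx.2), zero_mul]
  constructor
  · have := integrableOn_Ioi_deriv_of_nonneg hcont hd hnn hlim
    exact this.of_forall_sdiff_eq_zero measurableSet_Ioi hzero
  · rw [setIntegral_eq_of_subset_of_forall_sdiff_eq_zero measurableSet_Ioi hsub hzero,
      integral_Ioi_of_hasDerivAt_of_nonneg hcont hd hnn hlim]
    simp
    ring

/-! ### The incomplete Legendre integral with upper limit `π` -/

/-- Integration by parts has no boundary terms because `sin(nπ) = 0`: this is where the integrality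
of `n` meets the upper limit `π`. It improves the decay in `x` from `x^(-1/2)` to `x^(-3/2)`. -/
theorem integral_cos_div_sqrt {n : ℕ} (hn : n ≠ 0) {x : ℝ} (hx : 1 < x) :
    ∫ t in (0 : ℝ)..Real.pi, Real.cos (n * t) * (Real.sqrt (x + Real.cosh t))⁻¹ =
      1 / (2 * n) * ∫ t in (0 : ℝ)..Real.pi, Real.sin (n * t) * Real.sinh t *
        ((x + Real.cosh t) * Real.sqrt (x + Real.cosh t))⁻¹ := by
  have hn' : (n : ℝ) ≠ 0 := by exact_mod_cast hn
  have hpos : ∀ t : ℝ, 0 < x + Real.cosh t := fun t => by linarith [Real.one_le_cosh t]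
  have hsp : ∀ t : ℝ, 0 < Real.sqrt (x + Real.cosh t) := fun t => Real.sqrt_pos.2 (hpos t)
  have h := intervalIntegral.integral_mul_deriv_eq_deriv_mul (a := 0) (b := Real.pi)
    (u := fun t => (Real.sqrt (x + Real.cosh t))⁻¹) (v := fun t => Real.sin (n * t) / n)
    (u' := fun t => -(1 / 2) * (Real.sinh t * ((x + Real.cosh t) *
      Real.sqrt (x + Real.cosh t))⁻¹))
    (v' := fun t => Real.cos (n * t))
    (fun t _ => by
      have h := (((Real.hasDerivAt_cosh t).const_add x).sqrt (hpos t).ne').inv (hsp t).ne'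
      refine h.congr_deriv ?_
      have h1 := hsp t
      have h2 := hpos t
      rw [Real.sq_sqrt (hpos t).le]
      field_simp)
    (fun t _ => by
      have h := (((hasDerivAt_id t).const_mul (n : ℝ)).sin).div_const (n : ℝ)
      refine h.congr_deriv ?_
      simp only [id]
      field_simp)
    (by
      refine Continuous.intervalIntegrable ?_ _ _
      refine continuous_const.mul (Real.continuous_sinh.mul (Continuous.inv₀ (by fun_prop) ?_))
      exact fun t => (mul_pos (hpos t) (hsp t)).ne')
    ((by fun_prop : Continuous fun t : ℝ => Real.cos (n * t)).intervalIntegrable _ _)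
  simp only [Real.sin_nat_mul_pi, mul_zero, Real.sin_zero, zero_div, sub_zero, zero_sub] at h
  simp only [mul_comm (Real.cos _)]
  rw [h, ← intervalIntegral.integral_neg, ← intervalIntegral.integral_const_mul]
  refine intervalIntegral.integral_congr fun t _ => ?_
  have h1 := hsp t
  have h2 := hpos t
  field_simp

theorem Gamma_half_add_mul_Gamma_half_sub (τ : ℝ) :
    Complex.Gamma (1 / 2 + Complex.I * τ) * Complex.Gamma (1 / 2 - Complex.I * τ) =
      Real.pi / Complex.cosh (Real.pi * τ) := by
  have h := Complex.Gamma_mul_Gamma_one_sub (1 / 2 + Complex.I * τ)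
  have e : (1 : ℂ) - (1 / 2 + Complex.I * τ) = 1 / 2 - Complex.I * τ := by ring
  have e2 : (Real.pi : ℂ) * (1 / 2 + Complex.I * τ) =
      Real.pi * τ * Complex.I + Real.pi / 2 := by ring
  rw [e, e2, Complex.sin_add_pi_div_two, Complex.cos_mul_I] at h
  exact h

/-- At `ν + 1/2 = in` the hyperbolic cosine becomes `cos(nt)`, and the reflection formula turns the
Gamma factors into `cosh(πn)/π`. In particular the value is real. -/
theorem incompleteLegendreP_eq_integral {n : ℕ} (hn : n ≠ 0) {x : ℝ} (hx : 1 < x) :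
    incompleteLegendreP 0 (Complex.I * n - 1 / 2) x Real.pi =
      ((Real.sqrt 2 * Real.cosh (Real.pi * n) / (2 * Real.pi * n) *
        ∫ t in (0 : ℝ)..Real.pi, Real.sin (n * t) * Real.sinh t *
          ((x + Real.cosh t) * Real.sqrt (x + Real.cosh t))⁻¹ : ℝ) : ℂ) := by
  have hint : (∫ t in (0 : ℝ)..Real.pi, Complex.cosh (t * (Complex.I * n - 1 / 2 + 1 / 2)) /
      ((Real.cosh t + x : ℝ) : ℂ) ^ ((1 : ℂ) / 2 - 0)) =
      ((∫ t in (0 : ℝ)..Real.pi, Real.cos (n * t) * (Real.sqrt (x + Real.cosh t))⁻¹ : ℝ) : ℂ) := by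
    rw [← intervalIntegral.integral_ofReal]
    refine intervalIntegral.integral_congr fun t _ => ?_
    have e : (t : ℂ) * (Complex.I * n - 1 / 2 + 1 / 2) = (n * t) * Complex.I := by ring
    have h2 : 0 ≤ Real.cosh t + x := by linarith [Real.one_le_cosh t]
    rw [e, Complex.cosh_mul_I, add_comm x, Real.sqrt_eq_rpow, div_eq_mul_inv,
      Complex.ofReal_mul, Complex.ofReal_inv, Complex.ofReal_cpow h2]
    push_cast
    rw [sub_zero]
  have hG := Gamma_half_add_mul_Gamma_half_sub n
  have e1 : 1 + (Complex.I * n - 1 / 2) - 0 = 1 / 2 + Complex.I * ((n : ℝ) : ℂ) := by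
    push_cast; ring
  have e2 : -(Complex.I * n - 1 / 2) - 0 = 1 / 2 - Complex.I * ((n : ℝ) : ℂ) := by
    push_cast; ring
  rw [incompleteLegendreP, hint, integral_cos_div_sqrt hn hx, e1, e2, hG, neg_zero, zero_div,
    Complex.cpow_zero, sub_zero, Complex.Gamma_one_half_eq]
  have hpi : (Real.sqrt (2 / Real.pi) : ℂ) * (Real.pi : ℂ) ^ (1 / 2 : ℂ) = (Real.sqrt 2 : ℂ) := by
    have : Real.sqrt 2 = Real.sqrt (2 / Real.pi) * Real.pi ^ (1 / 2 : ℝ) := by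
      rw [← Real.sqrt_eq_rpow, ← Real.sqrt_mul (by positivity)]
      congr 1
      field_simp
    rw [this, Complex.ofReal_mul, Complex.ofReal_cpow Real.pi_pos.le]
    push_cast; rfl
  have hpi0 : (Real.pi : ℂ) ≠ 0 := by exact_mod_cast Real.pi_ne_zero
  have hn0 : (n : ℂ) ≠ 0 := by exact_mod_cast hn
  have hch : Complex.cosh (Real.pi * ((n : ℝ) : ℂ)) ≠ 0 := by
    rw [← Complex.ofReal_mul, ← Complex.ofReal_cosh]
    exact_mod_cast (Real.cosh_pos _).ne'
  rw [mul_one, ← mul_div_assoc, hpi]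
  push_cast at hch ⊢
  field_simp

/-! ### Conical functions integrated against `(x + c)^(-3/2)`, and uniform bounds -/

/-- The integral kernel of the integrated conical transform,
`(x + c)⁻¹ (x + c)^(-1/2)`. -/
noncomputable def decayKernel (c x : ℝ) : ℝ := ((x + c) * Real.sqrt (x + c))⁻¹

theorem decayKernel_pos {c x : ℝ} (h : 0 < x + c) : 0 < decayKernel c x := by
  have := Real.sqrt_pos.2 h
  unfold decayKernel
  positivity

theorem decayKernel_le {c d x : ℝ} (hcd : c ≤ d) (h : 0 < x + c) :
    decayKernel d x ≤ decayKernel c x := by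
  have h1 := Real.sqrt_pos.2 h
  unfold decayKernel
  refine inv_anti₀ (by positivity) ?_
  have hle : x + c ≤ x + d := by linarith
  exact mul_le_mul hle (Real.sqrt_le_sqrt hle) (Real.sqrt_nonneg _) (h.le.trans hle)

theorem measurable_decayKernel : Measurable fun p : ℝ × ℝ => decayKernel p.1 p.2 := by
  unfold decayKernel
  fun_prop

/-- By Tonelli with `x` integrated first: that integral is known exactly, and `√2/(cosh s + c)` is
integrable in `s`. -/
theorem integrable_prod_mehlerKernel {c : ℝ} (hc : 1 ≤ c) :
    Integrable (fun p : ℝ × ℝ => mehlerKernel p.1 p.2 * decayKernel c p.1)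
      ((volume.restrict (Set.Ioi 1)).prod volume) := by
  have hm : Measurable fun p : ℝ × ℝ => mehlerKernel p.1 p.2 * decayKernel c p.1 :=
    measurable_mehlerKernel.mul
      (measurable_decayKernel.comp (measurable_const.prodMk measurable_fst))
  rw [integrable_prod_iff' hm.aestronglyMeasurable]
  refine ⟨Filter.Eventually.of_forall fun s => (integral_Ioi_mehlerKernel_mul hc s).1, ?_⟩
  refine ((integrable_inv_cosh_add hc).const_mul (Real.sqrt 2)).congr
    (Filter.Eventually.of_forall fun s => ?_)
  simp only
  rw [← (integral_Ioi_mehlerKernel_mul hc s).2]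
  refine setIntegral_congr_fun measurableSet_Ioi fun x hx => ?_
  have h1 : (1 : ℝ) < x := hx
  exact (Real.norm_of_nonneg (mul_nonneg (mehlerKernel_nonneg _ _)
    (decayKernel_pos (by linarith)).le)).symm

theorem integrable_prod_exp_mul_mehlerKernel (m : ℝ) {c : ℝ} (hc : 1 ≤ c) :
    Integrable (fun p : ℝ × ℝ => Complex.exp (Complex.I * m * p.2) *
      ((mehlerKernel p.1 p.2 * decayKernel c p.1 : ℝ) : ℂ))
      ((volume.restrict (Set.Ioi 1)).prod volume) :=
  (integrable_prod_mehlerKernel hc).ofReal.bdd_mul (c := 1)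
    (Continuous.aestronglyMeasurable (by fun_prop))
    (Filter.Eventually.of_forall fun p => (norm_exp_I_mul_mul m p.2).le)

theorem integral_exp_mul_mehlerKernel_mul (m : ℝ) (c : ℝ) {x : ℝ} (hx : 1 < x) :
    ∫ s : ℝ, Complex.exp (Complex.I * m * s) * ((mehlerKernel x s * decayKernel c x : ℝ) : ℂ) =
      Real.pi * (legendreP 0 (Complex.I * m - 1 / 2) x * decayKernel c x) := by
  have hpi : (Real.pi : ℂ) ≠ 0 := by exact_mod_cast Real.pi_ne_zero
  rw [legendreP_eq_integral_mehlerKernel m hx]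
  simp only [Complex.ofReal_mul, ← mul_assoc]
  rw [integral_mul_const]
  field_simp

theorem integrableOn_legendreP_mul_decayKernel (m : ℝ) {c : ℝ} (hc : 1 ≤ c) :
    IntegrableOn (fun x => legendreP 0 (Complex.I * m - 1 / 2) x * (decayKernel c x : ℂ))
      (Set.Ioi 1) := by
  have h := (integrable_prod_exp_mul_mehlerKernel m hc).integral_prod_left.const_mul
    (Real.pi : ℂ)⁻¹
  refine IntegrableOn.congr_fun h (fun x hx => ?_) measurableSet_Ioi
  have hpi : (Real.pi : ℂ) ≠ 0 := by exact_mod_cast Real.pi_ne_zero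
  simp only
  rw [integral_exp_mul_mehlerKernel_mul m c hx, inv_mul_cancel_left₀ hpi]

/-- Fubini applied to the Mehler–Dirichlet integral reduces this to the Fourier transform of
`1/(cosh s + cosh t)`. Keeping `sinh t` as a factor avoids dividing by zero at `t = 0`. -/
theorem sinh_mul_integral_legendreP_mul_decayKernel {m : ℝ} (hm : m ≠ 0) (t : ℝ) :
    Real.sinh t * ∫ x in Set.Ioi (1 : ℝ),
      legendreP 0 (Complex.I * m - 1 / 2) x * (decayKernel (Real.cosh t) x : ℂ) =
      2 * Real.sqrt 2 * Complex.sin (m * t) / Complex.sinh (Real.pi * m) := by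
  have hc := Real.one_le_cosh t
  have hpi : (Real.pi : ℂ) ≠ 0 := by exact_mod_cast Real.pi_ne_zero
  have hswap := integral_integral_swap
    (f := fun x s : ℝ => Complex.exp (Complex.I * m * s) *
      ((mehlerKernel x s * decayKernel (Real.cosh t) x : ℝ) : ℂ))
    (integrable_prod_exp_mul_mehlerKernel m hc)
  have h1 : ∫ x in Set.Ioi (1 : ℝ), ∫ s : ℝ, Complex.exp (Complex.I * m * s) *
      ((mehlerKernel x s * decayKernel (Real.cosh t) x : ℝ) : ℂ) =
      Real.pi * ∫ x in Set.Ioi (1 : ℝ),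
        legendreP 0 (Complex.I * m - 1 / 2) x * (decayKernel (Real.cosh t) x : ℂ) := by
    rw [← integral_const_mul]
    exact setIntegral_congr_fun measurableSet_Ioi fun x hx =>
      integral_exp_mul_mehlerKernel_mul m _ hx
  have h2 : ∀ s : ℝ, ∫ x in Set.Ioi (1 : ℝ), Complex.exp (Complex.I * m * s) *
      ((mehlerKernel x s * decayKernel (Real.cosh t) x : ℝ) : ℂ) =
      Complex.exp (Complex.I * m * s) *
        ((Real.sqrt 2 * (1 / (Real.cosh s + Real.cosh t)) : ℝ) : ℂ) := by
    intro s
    rw [integral_const_mul, integral_complex_ofReal]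
    congr 2
    exact (integral_Ioi_mehlerKernel_mul hc s).2
  simp only [h1, h2] at hswap
  have h3 := integral_exp_div_cosh_add_cosh hm t
  have h4 : Real.sinh t * ∫ s : ℝ, Complex.exp (Complex.I * m * s) *
        ((Real.sqrt 2 * (1 / (Real.cosh s + Real.cosh t)) : ℝ) : ℂ) =
      Real.sqrt 2 * (2 * Real.pi * Complex.sin (m * t) / Complex.sinh (Real.pi * m)) := by
    rw [← h3, ← integral_const_mul, ← integral_const_mul]
    refine integral_congr_ae (Filter.Eventually.of_forall fun s => ?_)
    simp only
    push_cast; ring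
  rw [← hswap] at h4
  have h5 : (Real.pi : ℂ) * (Real.sinh t * ∫ x in Set.Ioi (1 : ℝ),
      legendreP 0 (Complex.I * m - 1 / 2) x * (decayKernel (Real.cosh t) x : ℂ)) =
      Real.pi * (2 * Real.sqrt 2 * Complex.sin (m * t) / Complex.sinh (Real.pi * m)) := by
    linear_combination h4
  exact mul_left_cancel₀ hpi h5

/-- The kernel is nonnegative and the exponential has modulus one. The bound, which is the value at
`m = 0`, does not depend on `m`, so it controls the whole series at once. -/
theorem norm_legendreP_le (m : ℝ) {x : ℝ} (hx : 1 < x) :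
    ‖legendreP 0 (Complex.I * m - 1 / 2) x‖ ≤ 1 / Real.pi * ∫ s : ℝ, mehlerKernel x s := by
  rw [legendreP_eq_integral_mehlerKernel m hx, norm_mul, norm_div, norm_one, Complex.norm_real,
    Real.norm_of_nonneg Real.pi_pos.le]
  refine mul_le_mul_of_nonneg_left ?_ (by positivity)
  refine norm_integral_le_of_norm_le (integrable_mehlerKernel hx)
    (Filter.Eventually.of_forall fun s => ?_)
  rw [norm_mul, norm_exp_I_mul_mul, one_mul, Complex.norm_real,
    Real.norm_of_nonneg (mehlerKernel_nonneg _ _)]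

theorem integrableOn_integral_mehlerKernel_mul :
    IntegrableOn (fun x => (∫ s : ℝ, mehlerKernel x s) * decayKernel 1 x) (Set.Ioi 1) := by
  have h := (integrable_prod_mehlerKernel le_rfl).integral_prod_left
  simp only [integral_mul_const] at h
  exact h

/-! ### Biorthogonality -/

theorem integral_sin_mul_sin (n : ℕ) {m : ℕ} (hm : m ≠ 0) :
    ∫ t in (0 : ℝ)..Real.pi, Real.sin (n * t) * Real.sin (m * t) =
      if n = m then Real.pi / 2 else 0 := by
  have hcos : ∀ k : ℤ, ∫ t in (0 : ℝ)..Real.pi, Real.cos (k * t) =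
      if k = 0 then Real.pi else 0 := by
    intro k
    split_ifs with h
    · subst h; simp
    · have hk : (k : ℝ) ≠ 0 := by exact_mod_cast h
      rw [intervalIntegral.integral_comp_mul_left (fun t => Real.cos t) hk, integral_cos]
      simp [Real.sin_int_mul_pi]
  have e : ∀ t : ℝ, Real.sin (n * t) * Real.sin (m * t) =
      (1 / 2) * Real.cos (((n - m : ℤ) : ℝ) * t) - (1 / 2) * Real.cos (((n + m : ℤ) : ℝ) * t) := by
    intro t
    push_cast
    rw [sub_mul, add_mul, Real.cos_sub, Real.cos_add]
    ring
  simp only [e]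
  rw [intervalIntegral.integral_sub (Continuous.intervalIntegrable (by fun_prop) _ _)
    (Continuous.intervalIntegrable (by fun_prop) _ _), intervalIntegral.integral_const_mul,
    intervalIntegral.integral_const_mul, hcos, hcos]
  have h1 : ((n : ℤ) - m = 0) ↔ n = m := by omega
  have h2 : ¬ ((n : ℤ) + m = 0) := by omega
  simp only [h1, h2, if_false]
  split_ifs <;> ring

theorem norm_sin_mul_sinh_mul_decayKernel_le (n : ℝ) {x t : ℝ} (hx : 1 < x)
    (ht : t ∈ Set.Ioc 0 Real.pi) :
    ‖Real.sin (n * t) * Real.sinh t * decayKernel (Real.cosh t) x‖ ≤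
      Real.sinh Real.pi * decayKernel 1 x := by
  have h0 : 0 ≤ Real.sinh t := Real.sinh_nonneg_iff.2 ht.1.le
  have h1 : Real.sinh t ≤ Real.sinh Real.pi := Real.sinh_le_sinh.2 ht.2
  have h2 := decayKernel_le (Real.one_le_cosh t) (x := x) (by linarith)
  have h3 := (decayKernel_pos (c := Real.cosh t) (x := x)
    (by linarith [Real.one_le_cosh t])).le
  rw [norm_mul, norm_mul, Real.norm_of_nonneg h0, Real.norm_of_nonneg h3]
  refine mul_le_mul ?_ h2 h3 (h0.trans h1)
  calc ‖Real.sin (n * t)‖ * Real.sinh t ≤ 1 * Real.sinh t :=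
        mul_le_mul_of_nonneg_right (Real.abs_sin_le_one _) h0
    _ ≤ Real.sinh Real.pi := by rwa [one_mul]

theorem norm_incompleteLegendreP_le {n : ℕ} (hn : n ≠ 0) {x : ℝ} (hx : 1 < x) :
    ‖incompleteLegendreP 0 (Complex.I * n - 1 / 2) x Real.pi‖ ≤
      Real.sqrt 2 * Real.cosh (Real.pi * n) / (2 * Real.pi * n) *
        (Real.sinh Real.pi * Real.pi) * decayKernel 1 x := by
  have hC : 0 ≤ Real.sqrt 2 * Real.cosh (Real.pi * n) / (2 * Real.pi * n) := by
    have := Real.cosh_pos (Real.pi * n)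
    positivity
  rw [incompleteLegendreP_eq_integral hn hx, Complex.norm_real, norm_mul,
    Real.norm_of_nonneg hC]
  refine (mul_le_mul_of_nonneg_left ?_ hC).trans_eq (mul_assoc _ _ _).symm
  refine (intervalIntegral.norm_integral_le_of_norm_le_const
    (C := Real.sinh Real.pi * decayKernel 1 x) fun t ht => ?_).trans_eq ?_
  · rw [Set.uIoc_of_le Real.pi_pos.le] at ht
    exact norm_sin_mul_sinh_mul_decayKernel_le n hx ht
  · rw [sub_zero, abs_of_pos Real.pi_pos]; ring

/-- Dividing by `decayKernel 1` leaves a factor bounded by `sinh π`; the rest is an integrable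
function of `x` alone, on a product with a finite measure in `t`. -/
theorem integrable_prod_decayKernel_mul_legendreP (n m : ℝ) :
    Integrable (fun p : ℝ × ℝ =>
      ((Real.sin (n * p.2) * Real.sinh p.2 * decayKernel (Real.cosh p.2) p.1 : ℝ) : ℂ) *
        legendreP 0 (Complex.I * m - 1 / 2) p.1)
      ((volume.restrict (Set.Ioi 1)).prod (volume.restrict (Set.Ioc 0 Real.pi))) := by
  have h := Integrable.comp_fst (integrableOn_legendreP_mul_decayKernel m le_rfl)
    (volume.restrict (Set.Ioc 0 Real.pi))
  have hm : Measurable fun p : ℝ × ℝ =>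
      ((Real.sin (n * p.2) * Real.sinh p.2 * decayKernel (Real.cosh p.2) p.1 *
        (decayKernel 1 p.1)⁻¹ : ℝ) : ℂ) := by
    have h1 : Measurable fun p : ℝ × ℝ => decayKernel (Real.cosh p.2) p.1 :=
      measurable_decayKernel.comp
        ((Real.measurable_cosh.comp measurable_snd).prodMk measurable_fst)
    have h2 : Measurable fun p : ℝ × ℝ => decayKernel 1 p.1 :=
      measurable_decayKernel.comp (measurable_const.prodMk measurable_fst)
    have h3 : Measurable Real.sinh := Real.measurable_sinh
    fun_prop
  have hmem : ∀ᵐ p ∂((volume.restrict (Set.Ioi (1 : ℝ))).prod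
      (volume.restrict (Set.Ioc 0 Real.pi))), p ∈ Set.Ioi (1 : ℝ) ×ˢ Set.Ioc 0 Real.pi := by
    rw [Measure.prod_restrict]
    exact ae_restrict_mem (measurableSet_Ioi.prod measurableSet_Ioc)
  refine (h.bdd_mul (c := Real.sinh Real.pi) hm.aestronglyMeasurable ?_).congr ?_
  · filter_upwards [hmem] with p hp
    have h1 : (1 : ℝ) < p.1 := hp.1
    have h2 := decayKernel_pos (c := 1) (x := p.1) (by linarith)
    rw [Complex.norm_real, norm_mul, norm_inv, Real.norm_of_nonneg h2.le, ← div_eq_mul_inv,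
      div_le_iff₀ h2]
    exact norm_sin_mul_sinh_mul_decayKernel_le n h1 hp.2
  · filter_upwards [hmem] with p hp
    have h1 : (1 : ℝ) < p.1 := hp.1
    have h2 : (decayKernel 1 p.1 : ℂ) ≠ 0 := by
      exact_mod_cast (decayKernel_pos (c := 1) (x := p.1) (by linarith)).ne'
    push_cast
    field_simp

theorem incompleteLegendreP_mul_legendreP_eq_integral {n : ℕ} (hn : n ≠ 0) (m : ℝ) {x : ℝ}
    (hx : 1 < x) :
    incompleteLegendreP 0 (Complex.I * n - 1 / 2) x Real.pi *
      legendreP 0 (Complex.I * m - 1 / 2) x =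
      ((Real.sqrt 2 * Real.cosh (Real.pi * n) / (2 * Real.pi * n) : ℝ) : ℂ) *
        ∫ t in Set.Ioc 0 Real.pi,
          ((Real.sin (n * t) * Real.sinh t * decayKernel (Real.cosh t) x : ℝ) : ℂ) *
            legendreP 0 (Complex.I * m - 1 / 2) x := by
  rw [incompleteLegendreP_eq_integral hn hx, integral_mul_const, integral_complex_ofReal,
    intervalIntegral.integral_of_le Real.pi_pos.le, Complex.ofReal_mul, mul_assoc]
  rfl

theorem integrableOn_incompleteLegendreP_mul_legendreP {n : ℕ} (hn : n ≠ 0) (m : ℝ) :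
    IntegrableOn (fun x => incompleteLegendreP 0 (Complex.I * n - 1 / 2) x Real.pi *
      legendreP 0 (Complex.I * m - 1 / 2) x) (Set.Ioi 1) := by
  refine IntegrableOn.congr_fun
    ((integrable_prod_decayKernel_mul_legendreP n m).integral_prod_left.const_mul
      ((Real.sqrt 2 * Real.cosh (Real.pi * n) / (2 * Real.pi * n) : ℝ) : ℂ))
    (fun x hx => ?_) measurableSet_Ioi
  exact (incompleteLegendreP_mul_legendreP_eq_integral hn m hx).symm

/-- Biorthogonality of the conical functions and the incomplete Legendre integrals. -/
theorem integral_incompleteLegendreP_mul_legendreP {n m : ℕ} (hn : n ≠ 0) (hm : m ≠ 0) :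
    ∫ x in Set.Ioi (1 : ℝ), incompleteLegendreP 0 (Complex.I * n - 1 / 2) x Real.pi *
      legendreP 0 (Complex.I * m - 1 / 2) x =
      if n = m then Complex.cosh (Real.pi * n) / (n * Complex.sinh (Real.pi * n)) else 0 := by
  have hm' : (m : ℝ) ≠ 0 := by exact_mod_cast hm
  -- For fixed `t` the `x`-integral already produces `sin(mt)`; after the swap in `h2` only the
  -- orthogonality of sines is left.
  have h1 : ∀ t : ℝ, ∫ x in Set.Ioi (1 : ℝ),
      ((Real.sin (n * t) * Real.sinh t * decayKernel (Real.cosh t) x : ℝ) : ℂ) *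
        legendreP 0 (Complex.I * (m : ℝ) - 1 / 2) x =
      2 * Real.sqrt 2 / Complex.sinh (Real.pi * (m : ℝ)) *
        ((Real.sin (n * t) * Real.sin (m * t) : ℝ) : ℂ) := by
    intro t
    have h := sinh_mul_integral_legendreP_mul_decayKernel hm' t
    have e : ∫ x in Set.Ioi (1 : ℝ),
      ((Real.sin (n * t) * Real.sinh t * decayKernel (Real.cosh t) x : ℝ) : ℂ) *
        legendreP 0 (Complex.I * (m : ℝ) - 1 / 2) x =
        Real.sin (n * t) * (Real.sinh t * ∫ x in Set.Ioi (1 : ℝ),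
      legendreP 0 (Complex.I * (m : ℝ) - 1 / 2) x * (decayKernel (Real.cosh t) x : ℂ)) := by
      rw [← integral_const_mul, ← integral_const_mul]
      refine integral_congr_ae (Filter.Eventually.of_forall fun x => ?_)
      simp only
      push_cast; ring
    rw [e, h]
    push_cast; ring
  have h2 : ∫ x in Set.Ioi (1 : ℝ), incompleteLegendreP 0 (Complex.I * n - 1 / 2) x Real.pi *
      legendreP 0 (Complex.I * (m : ℝ) - 1 / 2) x =
      ((Real.sqrt 2 * Real.cosh (Real.pi * n) / (2 * Real.pi * n) : ℝ) : ℂ) *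
        (2 * Real.sqrt 2 / Complex.sinh (Real.pi * (m : ℝ)) *
          ((if n = m then Real.pi / 2 else 0 : ℝ) : ℂ)) := by
    rw [setIntegral_congr_fun measurableSet_Ioi fun x hx =>
      incompleteLegendreP_mul_legendreP_eq_integral hn m hx, integral_const_mul,
      integral_integral_swap
        (f := fun x t : ℝ =>
          ((Real.sin (n * t) * Real.sinh t * decayKernel (Real.cosh t) x : ℝ) : ℂ) *
            legendreP 0 (Complex.I * (m : ℝ) - 1 / 2) x)
        (integrable_prod_decayKernel_mul_legendreP n m)]
    simp only [h1]
    rw [integral_const_mul, integral_complex_ofReal, ← intervalIntegral.integral_of_le Real.pi_pos.le,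
      integral_sin_mul_sin n hm]
  simp only [Complex.ofReal_natCast] at h2
  rw [h2]
  split_ifs with h
  · subst h
    have hpi : (Real.pi : ℂ) ≠ 0 := by exact_mod_cast Real.pi_ne_zero
    have hn0 : (n : ℂ) ≠ 0 := by exact_mod_cast hn
    have hs : Complex.sinh (Real.pi * n) ≠ 0 := by
      have := Real.sinh_ne_zero.2 (mul_ne_zero Real.pi_ne_zero hm')
      exact_mod_cast this
    have h2 : (Real.sqrt 2 : ℂ) ^ 2 = 2 := by
      exact_mod_cast Real.sq_sqrt zero_le_two
    push_cast
    field_simp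
    rw [h2, mul_comm]
  · simp

/-! ### Recovery of the coefficients by termwise integration -/

theorem corollary1 (a : ℕ+ → ℂ) (ha : Summable fun m : ℕ+ => ‖a m‖) (n : ℕ+) :
    (∀ x : ℝ, 1 < x → Summable fun m : ℕ+ => ‖a m * legendreP 0 (Complex.I * m - 1 / 2) x‖) ∧
    IntegrableOn (fun x : ℝ => ‖incompleteLegendreP 0 (Complex.I * n - 1 / 2) x Real.pi‖ *
      ∑' m : ℕ+, ‖a m * legendreP 0 (Complex.I * m - 1 / 2) x‖) (Set.Ioi 1) ∧
    IntegrableOn (fun x : ℝ => incompleteLegendreP 0 (Complex.I * n - 1 / 2) x Real.pi *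
      ∑' m : ℕ+, a m * legendreP 0 (Complex.I * m - 1 / 2) x) (Set.Ioi 1) ∧
    a n = n * Complex.tanh (Real.pi * n) *
      ∫ x in Set.Ioi (1 : ℝ), incompleteLegendreP 0 (Complex.I * n - 1 / 2) x Real.pi *
        ∑' m : ℕ+, a m * legendreP 0 (Complex.I * m - 1 / 2) x := by
  have hn : (n : ℕ) ≠ 0 := n.ne_zero
  set Q : ℝ → ℂ := fun x => incompleteLegendreP 0 (Complex.I * n - 1 / 2) x Real.pi with hQ
  set P : ℕ+ → ℝ → ℂ := fun m x => legendreP 0 (Complex.I * m - 1 / 2) x with hP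
  set q : ℝ → ℝ := fun x => 1 / Real.pi * ∫ s : ℝ, mehlerKernel x s with hq
  obtain ⟨C, hC⟩ : ∃ C : ℝ, ∀ x, 1 < x → ‖Q x‖ ≤ C * decayKernel 1 x :=
    ⟨_, fun x hx => norm_incompleteLegendreP_le hn hx⟩
  have hPq : ∀ m x, 1 < x → ‖P m x‖ ≤ q x := fun m x hx => by
    have := norm_legendreP_le (m : ℕ) hx
    rwa [Complex.ofReal_natCast] at this
  have hbd : ∀ m x, 1 < x → ‖a m * P m x‖ ≤ ‖a m‖ * q x := fun m x hx => by
    rw [norm_mul]; exact mul_le_mul_of_nonneg_left (hPq m x hx) (norm_nonneg _)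
  have hsum : ∀ x, 1 < x → Summable fun m => ‖a m * P m x‖ := fun x hx =>
    Summable.of_nonneg_of_le (fun _ => norm_nonneg _) (fun m => hbd m x hx) (ha.mul_right (q x))
  -- The common majorant of all the products `Q x * P m x`; weighted by `‖a m‖` it dominates the
  -- series and its partial sums.
  have hqi : IntegrableOn (fun x => C * (q x * decayKernel 1 x)) (Set.Ioi 1) := by
    have := integrableOn_integral_mehlerKernel_mul.const_mul (C * (1 / Real.pi))
    refine this.congr (Filter.Eventually.of_forall fun x => ?_)
    simp only [hq]; ring
  have hQP : ∀ m, IntegrableOn (fun x => Q x * P m x) (Set.Ioi 1) := fun m => by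
    have := integrableOn_incompleteLegendreP_mul_legendreP hn (m : ℕ)
    rwa [Complex.ofReal_natCast] at this
  have hQPb : ∀ m x, 1 < x → ‖Q x * P m x‖ ≤ C * (q x * decayKernel 1 x) := fun m x hx => by
    rw [norm_mul, ← mul_assoc, mul_right_comm]
    exact mul_le_mul (hC x hx) (hPq m x hx) (norm_nonneg _) ((norm_nonneg _).trans (hC x hx))
  set F : ℕ+ → ℝ → ℂ := fun m x => a m * (Q x * P m x) with hF
  have hFi : ∀ m, IntegrableOn (F m) (Set.Ioi 1) := fun m => (hQP m).const_mul (a m)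
  have hFn : ∀ m x, ‖Q x‖ * ‖a m * P m x‖ = ‖F m x‖ := fun m x => by
    simp only [hF, norm_mul]; ring
  have hFb : ∀ m x, 1 < x → ‖F m x‖ ≤ ‖a m‖ * (C * (q x * decayKernel 1 x)) := fun m x hx => by
    rw [hF]
    simp only
    rw [norm_mul]
    exact mul_le_mul_of_nonneg_left (hQPb m x hx) (norm_nonneg _)
  have hFs : ∀ x, 1 < x → Summable fun m => ‖F m x‖ := fun x hx =>
    Summable.of_nonneg_of_le (fun _ => norm_nonneg _) (fun m => hFb m x hx) (ha.mul_right _)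
  have hdom : IntegrableOn (fun x => (∑' m, ‖a m‖) * (C * (q x * decayKernel 1 x)))
      (Set.Ioi 1) := hqi.const_mul _
  have hFt : ∀ x, 1 < x → ∑' m, ‖F m x‖ ≤ (∑' m, ‖a m‖) * (C * (q x * decayKernel 1 x)) :=
    fun x hx => by
      rw [← tsum_mul_right]
      exact (hFs x hx).tsum_le_tsum (fun m => hFb m x hx) (ha.mul_right _)
  have hnorm : IntegrableOn (fun x => ∑' m, ‖F m x‖) (Set.Ioi 1) := by
    -- Measurability of the sum comes from its being a pointwise limit of finite partial sums on `x
    -- > 1`.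
    refine hdom.mono' (aestronglyMeasurable_of_tendsto_ae Filter.atTop
      (f := fun (s : Finset ℕ+) x => ∑ m ∈ s, ‖F m x‖)
      (fun s => (integrable_finsetSum s fun m _ => (hFi m).norm).aestronglyMeasurable) ?_) ?_
    · filter_upwards [ae_restrict_mem measurableSet_Ioi] with x hx
      exact (hFs x hx).hasSum
    · filter_upwards [ae_restrict_mem measurableSet_Ioi] with x hx
      rw [Real.norm_of_nonneg (tsum_nonneg fun m => norm_nonneg _)]
      exact hFt x hx
  have hint : IntegrableOn (fun x => ∑' m, F m x) (Set.Ioi 1) := by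
    refine hnorm.mono' (aestronglyMeasurable_of_tendsto_ae Filter.atTop
      (f := fun (s : Finset ℕ+) x => ∑ m ∈ s, F m x)
      (fun s => (integrable_finsetSum s fun m _ => hFi m).aestronglyMeasurable) ?_) ?_
    · filter_upwards [ae_restrict_mem measurableSet_Ioi] with x hx
      exact (hFs x hx).of_norm.hasSum
    · filter_upwards [ae_restrict_mem measurableSet_Ioi] with x hx
      exact norm_tsum_le_tsum_norm (hFs x hx)
  have hFe : ∀ x, Q x * ∑' m, a m * P m x = ∑' m, F m x := fun x => by
    rw [← tsum_mul_left]
    exact tsum_congr fun m => by simp only [hF]; ring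
  refine ⟨hsum, ?_, ?_, ?_⟩
  · refine hnorm.congr (Filter.Eventually.of_forall fun x => ?_)
    change _ = ‖Q x‖ * ∑' m, ‖a m * P m x‖
    simp only [← tsum_mul_left, hFn]
  · exact hint.congr (Filter.Eventually.of_forall fun x => (hFe x).symm)
  -- The integrals of the norms are at most `‖a m‖` times a constant, hence summable, which permits
  -- the exchange of sum and integral.
  · have hs := hasSum_integral_of_summable_integral_norm hFi (by
      refine Summable.of_nonneg_of_le (fun m => integral_nonneg fun x => norm_nonneg _)
        (fun m => ?_) (ha.mul_right (∫ x in Set.Ioi (1 : ℝ), C * (q x * decayKernel 1 x)))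
      rw [← integral_const_mul]
      exact setIntegral_mono_on (hFi m).norm (hqi.const_mul _) measurableSet_Ioi
        fun x hx => hFb m x hx)
    have hval : ∀ m, ∫ x in Set.Ioi (1 : ℝ), F m x = if m = n then
        a n * (Complex.cosh (Real.pi * n) / (n * Complex.sinh (Real.pi * n))) else 0 := by
      intro m
      simp only [hF, hQ, hP]
      rw [integral_const_mul, integral_incompleteLegendreP_mul_legendreP hn m.ne_zero]
      by_cases h : m = n
      · subst h; simp
      · have h' : (n : ℕ) ≠ m := fun e => h (PNat.coe_injective e).symm
        simp [h, h']
    simp only [hval] at hs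
    have hI := hs.unique (hasSum_ite_eq n _)
    have hJ : ∫ x in Set.Ioi (1 : ℝ), Q x * ∑' m, a m * P m x = _ :=
      (integral_congr_ae (Filter.Eventually.of_forall hFe)).trans hI
    rw [hJ, Complex.tanh_eq_sinh_div_cosh]
    have hn0 : (n : ℂ) ≠ 0 := by exact_mod_cast hn
    have hne : (Real.pi * (n : ℕ) : ℝ) ≠ 0 := mul_ne_zero Real.pi_ne_zero (by exact_mod_cast hn)
    have hsh : Complex.sinh (Real.pi * n) ≠ 0 := by
      have := Real.sinh_ne_zero.2 hne
      exact_mod_cast this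
    have hch : Complex.cosh (Real.pi * n) ≠ 0 := by
      have := (Real.cosh_pos (Real.pi * (n : ℕ))).ne'
      exact_mod_cast this
    generalize Complex.sinh (Real.pi * n) = S at *
    generalize Complex.cosh (Real.pi * n) = T at *
    field_simp
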